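/- Let $\mathscr D=\{2^{-u}[k,k+1): u,k\in\mathbb Z\}$ be the standard dyadic grid. For $I\in\mathscr D$ let $I_-,I_+$ be its left and right children, $\hat I$ its dyadic parent and $I^s$ its sibling (the other child of $\hat I$). Let $\mu$ be a Borel measure on $\mathbb R$ with $0<\mu(I)<\infty$ for all $I\in\mathscr D$ and $\mu([0,\infty))=\mu((-\infty,0))=\infty$. Write $\langle f\rangle_I=\mu(I)^{-1}\int_I f\,d\mu$, $\langle f,g\rangle=\int fg\,d\mu$, $$m(I)=\frac{\mu(I_-)\mu(I_+)}{\mu(I)},\qquad h_I=\sqrt{m(I)}\Big(\frac{\mathbf 1_{I_-}}{\mu(I_-)}-\frac{\mathbf 1_{I_+}}{\mu(I_+)}\Big),\qquad [\mu]_{\mathrm{sib}}=\sup_{I\in\mathscr D}\frac{m(I)}{m(I^s)},$$ and $$\mathcal Hf=\sum_{I\in\mathscr D}\big(\langle f,h_{I_+}\rangle h_{I_-}-\langle f,h_{I_-}\rangle h_{I_+}\big)\quad\text{(unconditional sum in }L^2(\mu)).$$ The measure $\mu$ is called sibling balanced if $[\mu]_{\mathrm{sib}}<\infty$. A collection $\mathcal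 S\subset\mathscr D$ is $\eta$-sparse if there are pairwise disjoint measurable sets $E_I\subset I$, $I\in\mathcal S$, with $\mu(E_I)\ge\eta\,\mu(I)$. For nonnegative $f_1,f_2$ put $$\mathcal A_{\mathcal S}(f_1,f_2)=\sum_{I\in\mathcal S}\langle f_1\rangle_I\langle f_2\rangle_I\,\mu(I),\qquad \mathcal E_1^{\mathcal S}(f_1,f_2)=\sum_{\substack{I,J\in\mathcal S\\ \hat I=(\hat J)^s}}\langle f_1\rangle_I\langle f_2\rangle_J\,m(\hat I)^{1/2}m(\hat J)^{1/2},$$ $$\mathcal E_2^{\mathcal S}(f_1,f_2)=\sum_{\substack{I,J\in\mathcal S\\ I=(\hat J)^s}}\langle f_1\rangle_I\langle f_2\rangle_J\,m(I)^{1/2}m(\hat J)^{1/2},\qquad \mathcal E_3^{\mathcal S}(f_1,f_2)=\sum_{\substack{I,J\in\mathcal S\\ J=(\hat I)^s}}\langle f_1\rangle_I\langle f_2\rangle_J\,m(\hat I)^{1/2}m(J)^{1/2}.$$ **Theorem (sparse domination for $\mathcal H$).** There are absolute constants $C>0$ and $\eta\in(0,1)$ such that, for every such measure $\mu$ that is sibling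 balanced and atomless, and for all nonnegative, bounded, compactly supported functions $f_1,f_2$, the series defining $\mathcal Hf_1$ converges unconditionally in $L^2(\mu)$, the function $(\mathcal Hf_1)f_2$ is $\mu$-integrable, and there is an $\eta$-sparse collection $\mathcal S\subset\mathscr D$ with $$|\langle\mathcal Hf_1,f_2\rangle|\le C\Big([\mu]_{\mathrm{sib}}^{1/2}\,\mathcal A_{\mathcal S}(f_1,f_2)+\sum_{i=1}^3\mathcal E_i^{\mathcal S}(f_1,f_2)\Big).$$ -/

import Mathlib

open MeasureTheory
open scoped ENNReal

/-- A dyadic interval of the standard grid: `⟨u, k⟩` stands for `2 ^ (-u) * [k, k + 1)`. -/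
@[ext]
structure DyadicInterval where
  scale : ℤ
  index : ℤ

namespace DyadicInterval

/-- The half-open interval `2 ^ (-u) * [k, k + 1)`, as a set of reals. -/
def toSet (I : DyadicInterval) : Set ℝ :=
  Set.Ico ((2 : ℝ) ^ (-I.scale) * I.index) ((2 : ℝ) ^ (-I.scale) * (I.index + 1))

/-- The left child `I₋`. -/
def left (I : DyadicInterval) : DyadicInterval := ⟨I.scale + 1, 2 * I.index⟩

/-- The right child `I₊`. -/
def right (I : DyadicInterval) : DyadicInterval := ⟨I.scale + 1, 2 * I.index + 1⟩

/-- The dyadic parent (integer division by `2` rounds down here). -/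
def parent (I : DyadicInterval) : DyadicInterval := ⟨I.scale - 1, I.index / 2⟩

/-- The sibling: the other child of the parent. -/
def sibling (I : DyadicInterval) : DyadicInterval :=
  ⟨I.scale, if Even I.index then I.index + 1 else I.index - 1⟩

end DyadicInterval

noncomputable section

namespace DyadicHilbert

/-- `m(I) = μ(I₋) μ(I₊) / μ(I)`. -/
def m (μ : Measure ℝ) (I : DyadicInterval) : ℝ :=
  μ.real I.left.toSet * μ.real I.right.toSet / μ.real I.toSet

/-- The sibling balance constant `[μ]_sib = sup_I m(I) / m(I^s)`, with values in `[0, ∞]`. -/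
def sibConst (μ : Measure ℝ) : ℝ≥0∞ :=
  ⨆ I : DyadicInterval, ENNReal.ofReal (m μ I / m μ I.sibling)

/-- `μ` is sibling balanced if `[μ]_sib < ∞`. -/
def SiblingBalanced (μ : Measure ℝ) : Prop := sibConst μ < ∞

/-- The Haar function `h_I = √m(I) (1_{I₋} / μ(I₋) - 1_{I₊} / μ(I₊))`. -/
def haar (μ : Measure ℝ) (I : DyadicInterval) : ℝ → ℝ := fun x =>
  √(m μ I) * (I.left.toSet.indicator (fun _ => (μ.real I.left.toSet)⁻¹) x -
    I.right.toSet.indicator (fun _ => (μ.real I.right.toSet)⁻¹) x)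

theorem memLp_haar (μ : Measure ℝ) (I : DyadicInterval) : MemLp (haar μ I) 2 μ := by
  have key : ∀ J : DyadicInterval,
      MemLp (J.toSet.indicator (fun _ => (μ.real J.toSet)⁻¹)) 2 μ := by
    intro J
    refine memLp_indicator_const 2 measurableSet_Ico _ ?_
    by_cases h : μ J.toSet = ∞
    · left
      simp [Measure.real, h]
    · exact Or.inr h
  exact ((key I.left).sub (key I.right)).const_mul _

/-- The Haar function as an element of `L²(μ)`. -/
def haarLp (μ : Measure ℝ) (I : DyadicInterval) : Lp ℝ 2 μ := (memLp_haar μ I).toLp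

/-- The pairing `⟨f, g⟩ = ∫ f g dμ`. -/
def pairing (μ : Measure ℝ) (f g : ℝ → ℝ) : ℝ := ∫ x, f x * g x ∂μ

/-- The `I`-th term `⟨f, h_{I₊}⟩ h_{I₋} - ⟨f, h_{I₋}⟩ h_{I₊}` of the series of the dyadic Hilbert
transform of `f`. -/
def hilbertTerm (μ : Measure ℝ) (f : ℝ → ℝ) (I : DyadicInterval) : Lp ℝ 2 μ :=
  pairing μ f (haar μ I.right) • haarLp μ I.left - pairing μ f (haar μ I.left) • haarLp μ I.right

/-- The dyadic Hilbert transform of `f`, the unconditional sum of the series in `L²(μ)`. -/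
def hilbert (μ : Measure ℝ) (f : ℝ → ℝ) : Lp ℝ 2 μ := ∑' I : DyadicInterval, hilbertTerm μ f I

/-- The collection `S` of dyadic intervals is `η`-sparse with respect to `μ`. -/
def IsSparse (μ : Measure ℝ) (η : ℝ) (S : Set DyadicInterval) : Prop :=
  ∃ E : DyadicInterval → Set ℝ,
    (∀ I ∈ S, MeasurableSet (E I) ∧ E I ⊆ I.toSet ∧
      ENNReal.ofReal η * μ I.toSet ≤ μ (E I)) ∧
    S.PairwiseDisjoint E

/-- The average `⟨f⟩_I = μ(I)⁻¹ ∫_I f dμ`. -/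
def avg (μ : Measure ℝ) (f : ℝ → ℝ) (I : DyadicInterval) : ℝ := ⨍ x in I.toSet, f x ∂μ

/-- The standard form `∑_{I ∈ S} ⟨f₁⟩_I ⟨f₂⟩_I μ(I)`. This and the following forms are applied to
nonnegative functions; they are sums of nonnegative terms, with values in `[0, ∞]`. -/
def sparseForm (μ : Measure ℝ) (S : Set DyadicInterval) (f₁ f₂ : ℝ → ℝ) : ℝ≥0∞ :=
  ∑' I : S, ENNReal.ofReal (avg μ f₁ I * avg μ f₂ I * μ.real (I : DyadicInterval).toSet)

/-- The form `E₁`: sum over pairs `I, J ∈ S` such that the parent of `I` is the sibling of the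
parent of `J`. -/
def sibForm₁ (μ : Measure ℝ) (S : Set DyadicInterval) (f₁ f₂ : ℝ → ℝ) : ℝ≥0∞ :=
  ∑' p : {p : DyadicInterval × DyadicInterval //
      p.1 ∈ S ∧ p.2 ∈ S ∧ p.1.parent = p.2.parent.sibling},
    ENNReal.ofReal (avg μ f₁ p.1.1 * avg μ f₂ p.1.2 *
      √(m μ p.1.1.parent) * √(m μ p.1.2.parent))

/-- The form `E₂`: sum over pairs `I, J ∈ S` such that `I` is the sibling of the parent of `J`. -/
def sibForm₂ (μ : Measure ℝ) (S : Set DyadicInterval) (f₁ f₂ : ℝ → ℝ) : ℝ≥0∞ :=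
  ∑' p : {p : DyadicInterval × DyadicInterval //
      p.1 ∈ S ∧ p.2 ∈ S ∧ p.1 = p.2.parent.sibling},
    ENNReal.ofReal (avg μ f₁ p.1.1 * avg μ f₂ p.1.2 *
      √(m μ p.1.1) * √(m μ p.1.2.parent))

/-- The form `E₃`: sum over pairs `I, J ∈ S` such that `J` is the sibling of the parent of `I`. -/
def sibForm₃ (μ : Measure ℝ) (S : Set DyadicInterval) (f₁ f₂ : ℝ → ℝ) : ℝ≥0∞ :=
  ∑' p : {p : DyadicInterval × DyadicInterval //
      p.1 ∈ S ∧ p.2 ∈ S ∧ p.2 = p.1.parent.sibling},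
    ENNReal.ofReal (avg μ f₁ p.1.1 * avg μ f₂ p.1.2 *
      √(m μ p.1.1.parent) * √(m μ p.1.2))

/-- The class of test functions: nonnegative, bounded, compactly supported (and measurable). -/
structure IsTestFun (μ : Measure ℝ) (f : ℝ → ℝ) : Prop where
  aestronglyMeasurable : AEStronglyMeasurable f μ
  nonneg : ∀ x, 0 ≤ f x
  bounded : ∃ M : ℝ, ∀ x, f x ≤ M
  hasCompactSupport : HasCompactSupport f

end DyadicHilbert

end

/-! ### Geometry of the dyadic grid. -/

namespace DyadicInterval

/-! Pairing the series with `f₂` term by term reduces everything to `∑_J |⟨f₁,h_J⟩ ⟨f₂,h_{J^s}⟩|`.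
The Haar functions are orthonormal, so Bessel makes this sum finite, and at least half of it is
carried by the scales finer than some `b`. A stopping time runs down from all intervals of scale
`b`: `K` stops below its current stopping interval `Q` when one of the two averages exceeds four
times its value at `Q` (`jump`). Chebyshev, once for each function, shows that the stopping children
fill at most half of `Q` (`tsum_stoppingChildren_jump_le`), whence sparseness.

A Haar coefficient is `√m(J)` times the difference of the averages over the two children. Each of
these is at most four times the stopping average, plus its own value if that child stops (the
`spike`). Expanding the product at `J` and `J^s`, spike against spike gives `E₁`, and a spike
against the average of a stopping sibling gives `E₂` or `E₃`. In the other products near a stopping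
interval, sibling balance gives `√m(J) √m(J^s) ≤ [μ]_sib^{1/2} min (m(J), m(J^s))`, and `m` is at
most the mass of the interval and of either child. Such products are therefore charged to masses of
stopping intervals, which are summed using disjointness of stopping children
(`tsum_contribution_le`).

There remain sibling pairs of one stopping region with no stopping children. A weighted
arithmetic-geometric inequality separates the two functions, and the Bellman function `x (8A - x)
μ(J)`, with `A` the stopping average, controls the sum of squared coefficients (`tsum_regular_le`).
The case analysis is `abs_coef_mul_coef_le`. -/

theorem mem_toSet_iff {I : DyadicInterval} {x : ℝ} :
    x ∈ I.toSet ↔ ⌊(2 : ℝ) ^ I.scale * x⌋ = I.index := by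
  have h2 : (0 : ℝ) < 2 ^ I.scale := by positivity
  rw [toSet, Set.mem_Ico, Int.floor_eq_iff, zpow_neg, inv_mul_le_iff₀ h2, lt_inv_mul_iff₀ h2]

/-- The dyadic interval of scale `u` containing `x`. -/
noncomputable def around (u : ℤ) (x : ℝ) : DyadicInterval := ⟨u, ⌊(2 : ℝ) ^ u * x⌋⟩

theorem mem_around (u : ℤ) (x : ℝ) : x ∈ (around u x).toSet := mem_toSet_iff.2 rfl

theorem eq_around {I : DyadicInterval} {x : ℝ} (h : x ∈ I.toSet) : I = around I.scale x := by
  ext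
  · rfl
  · exact (mem_toSet_iff.1 h).symm

theorem measurableSet_toSet (I : DyadicInterval) : MeasurableSet I.toSet := measurableSet_Ico

theorem nonempty_toSet (I : DyadicInterval) : I.toSet.Nonempty := by
  refine ⟨(2 : ℝ) ^ (-I.scale) * I.index, Set.left_mem_Ico.2 ?_⟩
  have : (0 : ℝ) < 2 ^ (-I.scale) := by positivity
  nlinarith

theorem eq_of_mem_of_mem {I J : DyadicInterval} {x : ℝ} (hs : I.scale = J.scale)
    (hI : x ∈ I.toSet) (hJ : x ∈ J.toSet) : I = J := by
  rw [eq_around hI, eq_around hJ, hs]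

@[simp] theorem left_scale (I : DyadicInterval) : I.left.scale = I.scale + 1 := rfl
@[simp] theorem right_scale (I : DyadicInterval) : I.right.scale = I.scale + 1 := rfl
@[simp] theorem parent_scale (I : DyadicInterval) : I.parent.scale = I.scale - 1 := rfl
@[simp] theorem sibling_scale (I : DyadicInterval) : I.sibling.scale = I.scale := rfl

@[simp] theorem left_parent (I : DyadicInterval) : I.left.parent = I := by
  ext <;> simp [left, parent]

@[simp] theorem right_parent (I : DyadicInterval) : I.right.parent = I := by
  ext
  · simp [right, parent]
  · simp only [right, parent]; omega

theorem eq_left_or_eq_right (J : DyadicInterval) : J = J.parent.left ∨ J = J.parent.right := by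
  rcases Int.even_or_odd' J.index with ⟨k, hk | hk⟩
  · left; ext
    · simp
    · simp only [left, parent]; omega
  · right; ext
    · simp
    · simp only [right, parent]; omega

@[simp] theorem left_sibling (I : DyadicInterval) : I.left.sibling = I.right := by
  ext <;> simp [left, right, sibling]

@[simp] theorem right_sibling (I : DyadicInterval) : I.right.sibling = I.left := by
  ext <;> simp [left, right, sibling]

theorem sibling_cases (J : DyadicInterval) :
    (J = J.parent.left ∧ J.sibling = J.parent.right) ∨
      (J = J.parent.right ∧ J.sibling = J.parent.left) := by
  rcases eq_left_or_eq_right J with h | h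
  · left; refine ⟨h, ?_⟩; rw [h]; simp
  · right; refine ⟨h, ?_⟩; rw [h]; simp

@[simp] theorem sibling_sibling (J : DyadicInterval) : J.sibling.sibling = J := by
  rcases sibling_cases J with ⟨h, h'⟩ | ⟨h, h'⟩ <;> rw [h'] <;> simp [← h]

@[simp] theorem sibling_parent (J : DyadicInterval) : J.sibling.parent = J.parent := by
  rcases sibling_cases J with ⟨h, h'⟩ | ⟨h, h'⟩ <;> rw [h'] <;> simp

theorem left_injective : Function.Injective left := fun I J h => by
  rw [← left_parent I, h, left_parent]

theorem right_injective : Function.Injective right := fun I J h => by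
  rw [← right_parent I, h, right_parent]

theorem sibling_injective : Function.Injective sibling := fun I J h => by
  rw [← sibling_sibling I, h, sibling_sibling]

theorem disjoint_left_right (I : DyadicInterval) : Disjoint I.left.toSet I.right.toSet := by
  rw [Set.disjoint_left]
  intro x h h'
  have := congrArg index (eq_of_mem_of_mem (by simp) h h')
  simp only [left, right] at this
  omega

theorem toSet_eq_union (I : DyadicInterval) : I.toSet = I.left.toSet ∪ I.right.toSet := by
  have hp : (2 : ℝ) ^ (-I.scale) = 2 * 2 ^ (-(I.scale + 1)) := by
    rw [neg_add, zpow_add₀ two_ne_zero]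
    norm_num
    ring
  have h0 : (0 : ℝ) < 2 ^ (-(I.scale + 1)) := by positivity
  simp only [toSet, left, right, hp]
  push_cast
  rw [show (2 : ℝ) ^ (-(I.scale + 1)) * (2 * (I.index : ℝ) + 1 + 1) =
    2 * 2 ^ (-(I.scale + 1)) * (I.index + 1) by ring, Set.Ico_union_Ico_eq_Ico]
  · ring_nf
  · nlinarith
  · nlinarith

theorem left_subset (I : DyadicInterval) : I.left.toSet ⊆ I.toSet := by
  rw [toSet_eq_union I]; exact Set.subset_union_left

theorem right_subset (I : DyadicInterval) : I.right.toSet ⊆ I.toSet := by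
  rw [toSet_eq_union I]; exact Set.subset_union_right

theorem subset_parent (J : DyadicInterval) : J.toSet ⊆ J.parent.toSet := by
  rcases eq_left_or_eq_right J with h | h
  · conv_lhs => rw [h]
    exact left_subset _
  · conv_lhs => rw [h]
    exact right_subset _

theorem around_parent (u : ℤ) (x : ℝ) : (around (u + 1) x).parent = around u x := by
  have h := eq_around (subset_parent _ (mem_around (u + 1) x))
  rw [h]
  simp [around]

/-- Nestedness of the grid, in the form of taking parents repeatedly. -/
theorem around_eq_of_le {u v : ℤ} (huv : u ≤ v) {x y : ℝ} (h : around v x = around v y) :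
    around u x = around u y := by
  induction v, huv using Int.leInduction with
  | base => exact h
  | succ v _ ih =>
    apply ih
    rw [← around_parent, h, around_parent]

theorem mem_of_scale_le {I J : DyadicInterval} (hs : I.scale ≤ J.scale) {x y : ℝ}
    (hx : x ∈ J.toSet) (hy : y ∈ J.toSet) (hI : x ∈ I.toSet) : y ∈ I.toSet := by
  have h : around J.scale x = around J.scale y := (eq_around hx).symm.trans (eq_around hy)
  rw [eq_around hI, around_eq_of_le hs h]
  exact mem_around _ _

/-! ### Sums over the dyadic tree. -/

/-- A dyadic interval is given by its scale and its index. -/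
def equivProd : DyadicInterval ≃ ℤ × ℤ where
  toFun I := (I.scale, I.index)
  invFun p := ⟨p.1, p.2⟩
  left_inv _ := rfl
  right_inv _ := rfl

instance : Countable DyadicInterval := equivProd.countable_iff.2 inferInstance

theorem tsum_children (F : DyadicInterval → ℝ≥0∞) (u : ℤ) :
    ∑' k : ℤ, (F (left ⟨u, k⟩) + F (right ⟨u, k⟩)) = ∑' k : ℤ, F ⟨u + 1, k⟩ := by
  rw [← (Int.divModEquiv 2).symm.tsum_eq fun k => F ⟨u + 1, k⟩, ENNReal.tsum_prod']
  refine tsum_congr fun k => ?_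
  rw [tsum_fintype, Fin.sum_univ_two]
  congr 1
  · refine congrArg F ?_
    ext
    · rfl
    · simp [left, Int.divModEquiv, mul_comm]
  · refine congrArg F ?_
    ext
    · rfl
    · simp [right, Int.divModEquiv, mul_comm]

/-- Telescoping over the dyadic tree. -/
theorem tsum_le_of_telescope (b : ℤ) (R Ψ N : DyadicInterval → ℝ≥0∞)
    (hR : ∀ J, b ≤ J.scale → R J + (Ψ J.left + Ψ J.right) ≤ Ψ J + (N J.left + N J.right))
    (hR0 : ∀ J, J.scale < b → R J = 0) (hΨ : ∀ J, J.scale = b → Ψ J ≤ N J) :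
    ∑' J, R J ≤ ∑' J, N J := by
  have rewr : ∀ F : DyadicInterval → ℝ≥0∞, ∑' J, F J = ∑' u : ℤ, ∑' k : ℤ, F ⟨u, k⟩ := by
    intro F
    rw [← equivProd.symm.tsum_eq, ENNReal.tsum_prod']
    rfl
  -- Level by level, `N` pays for all of `R` met so far and for the potential `Ψ` still stored at
  -- the current level. Keeping `Ψ` on the left avoids any subtraction in `ℝ≥0∞`.
  have step : ∀ n : ℕ, ∑ i ∈ Finset.range n, ∑' k : ℤ, R ⟨b + i, k⟩ + ∑' k : ℤ, Ψ ⟨b + n, k⟩ ≤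
      ∑ i ∈ Finset.range (n + 1), ∑' k : ℤ, N ⟨b + i, k⟩ := by
    intro n
    induction n with
    | zero => simpa using ENNReal.tsum_le_tsum fun k : ℤ => hΨ ⟨b, k⟩ rfl
    | succ n ih =>
      rw [Finset.sum_range_succ, Finset.sum_range_succ (n := n + 1)]
      have key : ∑' k : ℤ, R ⟨b + n, k⟩ + ∑' k : ℤ, Ψ ⟨b + n + 1, k⟩ ≤
          ∑' k : ℤ, Ψ ⟨b + n, k⟩ + ∑' k : ℤ, N ⟨b + n + 1, k⟩ := by
        rw [← tsum_children, ← tsum_children, ← ENNReal.tsum_add, ← ENNReal.tsum_add]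
        exact ENNReal.tsum_le_tsum fun k => hR ⟨b + n, k⟩ (by simp)
      push_cast
      rw [← add_assoc b]
      calc _ = ∑ i ∈ Finset.range n, ∑' k : ℤ, R ⟨b + i, k⟩ +
            (∑' k : ℤ, R ⟨b + n, k⟩ + ∑' k : ℤ, Ψ ⟨b + n + 1, k⟩) := by rw [add_assoc]
        _ ≤ _ := add_le_add_right key _
        _ = _ := (add_assoc _ _ _).symm
        _ ≤ _ := add_le_add_left ih _
  rw [rewr R, rewr N]
  have inj : Function.Injective fun n : ℕ => b + (n : ℤ) := fun m n h => by simpa using h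
  have h1 : ∑' u : ℤ, ∑' k : ℤ, R ⟨u, k⟩ = ∑' n : ℕ, ∑' k : ℤ, R ⟨b + n, k⟩ := by
    refine (inj.tsum_eq (f := fun u : ℤ => ∑' k : ℤ, R ⟨u, k⟩) ?_).symm
    intro u hu
    by_contra hcon
    apply hu
    have : u < b := by
      by_contra h
      exact hcon ⟨(u - b).toNat, by simp only; omega⟩
    exact ENNReal.tsum_eq_zero.2 fun k => hR0 _ this
  rw [h1]
  refine ENNReal.tsum_le_of_sum_range_le fun n => ?_
  refine (le_self_add.trans (step n)).trans ?_
  refine (ENNReal.sum_le_tsum _).trans ?_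
  exact ENNReal.tsum_comp_le_tsum_of_injective inj fun u : ℤ => ∑' k : ℤ, N ⟨u, k⟩

end DyadicInterval

/-! ### Stopping times, packing and sparseness. -/

namespace DyadicInterval

section Stopping

variable (halt : DyadicInterval → DyadicInterval → Prop) (b : ℤ)

open Classical in
/-- Auxiliary recursion for `own`. -/
noncomputable def ownAux : ℕ → DyadicInterval → DyadicInterval
  | 0, J => J
  | n + 1, J => if halt (ownAux n J.parent) J then J else ownAux n J.parent

/-- The last stopping interval met on the way from scale `b` down to `J`. -/
noncomputable def own (J : DyadicInterval) : DyadicInterval :=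
  ownAux halt (J.scale - b).toNat J

/-- The stopping intervals; all intervals of scale `b` belong to them. -/
def stopping : Set DyadicInterval := {J | b ≤ J.scale ∧ own halt b J = J}

/-- The stopping children of `Q`. -/
def stoppingChildren (Q : DyadicInterval) : Set DyadicInterval :=
  {K | b < K.scale ∧ K ∈ stopping halt b ∧ own halt b K.parent = Q}

variable {halt b}

theorem own_of_scale_le {J : DyadicInterval} (h : J.scale ≤ b) : own halt b J = J := by
  rw [own, Int.toNat_of_nonpos (by omega), ownAux]

theorem own_of_stop {J : DyadicInterval} (hb : b < J.scale) (h : halt (own halt b J.parent) J) :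
    own halt b J = J := by
  have e : (J.scale - b).toNat = (J.parent.scale - b).toNat + 1 := by
    rw [parent_scale]; omega
  rw [own] at h ⊢
  rw [e, ownAux, if_pos h]

theorem own_of_not_stop {J : DyadicInterval} (hb : b < J.scale)
    (h : ¬ halt (own halt b J.parent) J) : own halt b J = own halt b J.parent := by
  have e : (J.scale - b).toNat = (J.parent.scale - b).toNat + 1 := by
    rw [parent_scale]; omega
  conv_lhs => rw [own, e, ownAux]
  rw [own] at h
  rw [if_neg h, own]

theorem own_eq_self_or {J : DyadicInterval} (hb : b < J.scale) :
    own halt b J = J ∨ own halt b J = own halt b J.parent := by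
  by_cases h : halt (own halt b J.parent) J
  · exact .inl (own_of_stop hb h)
  · exact .inr (own_of_not_stop hb h)

theorem own_of_notMem {J : DyadicInterval} (hb : b < J.scale) (h : J ∉ stopping halt b) :
    own halt b J = own halt b J.parent :=
  (own_eq_self_or hb).resolve_left fun h' => h ⟨hb.le, h'⟩

/-- Induction from scale `b` downwards. -/
theorem scale_induction {P : DyadicInterval → Prop} (b : ℤ) (h0 : ∀ J, J.scale = b → P J)
    (h1 : ∀ J, b < J.scale → P J.parent → P J) (J : DyadicInterval) (hJ : b ≤ J.scale) : P J := by
  generalize hs : J.scale = s at hJ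
  induction s, hJ using Int.leInduction generalizing J with
  | base => exact h0 J hs
  | succ s hle ih => exact h1 J (by omega) (ih _ (by rw [parent_scale]; omega))

theorem own_spec {J : DyadicInterval} (hJ : b ≤ J.scale) :
    own halt b J ∈ stopping halt b ∧ J.toSet ⊆ (own halt b J).toSet ∧
      (own halt b J).scale ≤ J.scale := by
  refine scale_induction (P := fun J => own halt b J ∈ stopping halt b ∧
    J.toSet ⊆ (own halt b J).toSet ∧ (own halt b J).scale ≤ J.scale) b ?_ ?_ J hJ
  · intro J h
    have := own_of_scale_le (halt := halt) h.le
    exact ⟨⟨by rw [this, h], by rw [this, this]⟩, by rw [this], by rw [this]⟩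
  · intro J h ⟨h1, h2, h3⟩
    rcases own_eq_self_or (halt := halt) h with e | e
    · exact ⟨⟨by rw [e]; exact h.le, by rw [e, e]⟩, by rw [e], by rw [e]⟩
    · rw [e]
      rw [parent_scale] at h3
      exact ⟨h1, (subset_parent J).trans h2, by omega⟩

/-- Going down the branch through `x`, the stopping interval is either kept or replaced by a finer
one. -/
theorem scale_own_around_mono (x : ℝ) {u v : ℤ} (hu : b ≤ u) (huv : u ≤ v) :
    (own halt b (around u x)).scale ≤ (own halt b (around v x)).scale := by
  induction v, huv using Int.leInduction with
  | base => rfl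
  | succ v hv ih =>
    refine ih.trans ?_
    have hb : b < (around (v + 1) x).scale := by simp only [around]; omega
    rcases own_eq_self_or (halt := halt) hb with e | e
    · rw [e]
      have := (own_spec (halt := halt) (b := b) (J := around v x) (hu.trans hv)).2.2
      simp only [around] at this ⊢
      omega
    · rw [e, around_parent]

theorem subset_of_mem_stoppingChildren {Q K : DyadicInterval}
    (hK : K ∈ stoppingChildren halt b Q) : K.toSet ⊆ Q.toSet := by
  obtain ⟨h1, -, h3⟩ := hK
  rw [← h3]
  exact (subset_parent K).trans (own_spec (by rw [parent_scale]; omega)).2.1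

/-- If two stopping children met at different scales, the parent of the finer one would lie inside
the coarser one. Its stopping interval would then be at least as fine as the coarser child, hence
strictly finer than `Q`. -/
theorem disjoint_stoppingChildren (Q : DyadicInterval) :
    (stoppingChildren halt b Q).PairwiseDisjoint toSet := by
  have key : ∀ K ∈ stoppingChildren halt b Q, ∀ K' ∈ stoppingChildren halt b Q, ∀ x ∈ K.toSet,
      x ∈ K'.toSet → ¬ K.scale < K'.scale := by
    rintro K ⟨h1, h2, h3⟩ K' ⟨h1', h2', h3'⟩ x hx hx' hlt
    have eP : K'.parent = around (K'.scale - 1) x := eq_around (subset_parent _ hx')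
    have hmono := scale_own_around_mono (halt := halt) x h1.le
      (show K.scale ≤ K'.scale - 1 by omega)
    rw [← eP, h3', ← eq_around hx, h2.2] at hmono
    have := (own_spec (halt := halt) (b := b) (J := K.parent) (by rw [parent_scale]; omega)).2.2
    rw [h3, parent_scale] at this
    omega
  intro K hK K' hK' hne
  refine Set.disjoint_left.2 fun x hx hx' => hne (eq_of_mem_of_mem ?_ hx hx')
  have := key K hK K' hK' x hx hx'
  have := key K' hK' K hK x hx' hx
  omega

/-- The measure is arbitrary because the packing bound is needed for `μ` and for both measures `fᵢ
dμ`. -/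
theorem tsum_stoppingChildren_le (ν : Measure ℝ) (Q : DyadicInterval) :
    ∑' K : stoppingChildren halt b Q, ν (K : DyadicInterval).toSet ≤ ν Q.toSet := by
  refine (tsum_meas_le_meas_iUnion_of_disjoint ν
    (fun K : stoppingChildren halt b Q => measurableSet_toSet K.1) ?_).trans
    (measure_mono (Set.iUnion_subset fun K => subset_of_mem_stoppingChildren K.2))
  intro K K' hne
  exact disjoint_stoppingChildren Q K.2 K'.2 fun h => hne (Subtype.ext h)

/-- A point outside all stopping children of `Q` never leaves the region of `Q`. It thus determines
`Q`, which makes the sets `E_Q` disjoint. -/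
theorem own_around_eq {Q : DyadicInterval} (hQ : Q ∈ stopping halt b) {x : ℝ}
    (hx : x ∈ Q.toSet \ ⋃ K : stoppingChildren halt b Q, (K : DyadicInterval).toSet) {v : ℤ}
    (hv : Q.scale ≤ v) : own halt b (around v x) = Q := by
  induction v, hv using Int.leInduction with
  | base => rw [← eq_around hx.1, hQ.2]
  | succ v hv ih =>
    have hb : b < (around (v + 1) x).scale := by
      have := hQ.1
      simp only [around]; omega
    have hp : own halt b (around (v + 1) x).parent = Q := by rw [around_parent, ih]
    rcases own_eq_self_or (halt := halt) hb with e | e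
    · exact absurd (Set.mem_iUnion.2 ⟨⟨around (v + 1) x, hb, ⟨hb.le, e⟩, hp⟩, mem_around _ _⟩) hx.2
    · rw [e, hp]

/-- If the stopping children fill at most half of each stopping interval, the stopping intervals
form a sparse collection. -/
theorem isSparse_stopping (μ : Measure ℝ) (hfin : ∀ I : DyadicInterval, μ I.toSet ≠ ∞)
    (h : ∀ Q ∈ stopping halt b,
      ∑' K : stoppingChildren halt b Q, μ (K : DyadicInterval).toSet ≤ μ Q.toSet / 2) :
    DyadicHilbert.IsSparse μ (1 / 2) (stopping halt b) := by
  refine ⟨fun Q => Q.toSet \ ⋃ K : stoppingChildren halt b Q, (K : DyadicInterval).toSet, ?_, ?_⟩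
  · intro Q hQ
    refine ⟨(measurableSet_toSet Q).diff (.iUnion fun K => measurableSet_toSet K.1),
      Set.sdiff_subset, ?_⟩
    have hu : μ (⋃ K : stoppingChildren halt b Q, (K : DyadicInterval).toSet) ≤ μ Q.toSet / 2 :=
      (measure_iUnion_le _).trans (h Q hQ)
    refine le_trans ?_ (le_measure_sdiff)
    have e : ENNReal.ofReal (1 / 2) * μ Q.toSet = μ Q.toSet / 2 := by
      rw [one_div, ENNReal.ofReal_inv_of_pos two_pos, ENNReal.div_eq_inv_mul]
      norm_num
    rw [e]
    refine ENNReal.le_sub_of_add_le_left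
      (ne_top_of_le_ne_top (hfin Q) (hu.trans ENNReal.half_le_self)) ?_
    exact (add_le_add_left hu _).trans_eq (ENNReal.add_halves _)
  · intro Q hQ Q' hQ' hne
    refine Set.disjoint_left.2 fun x hx hx' => hne ?_
    exact (own_around_eq hQ hx (le_max_left Q.scale Q'.scale)).symm.trans
      (own_around_eq hQ' hx' (le_max_right Q.scale Q'.scale))

/-- Every stopping interval finer than `b` is a stopping child of some `Q`, so the sum can be
regrouped by `Q`. -/
theorem tsum_stopping_le (F : DyadicInterval → ℝ≥0∞) (G : DyadicInterval → ℝ≥0∞)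
    (h : ∀ Q ∈ stopping halt b, ∑' K : stoppingChildren halt b Q, F K ≤ G Q)
    (hF : ∀ K, ¬ (b < K.scale ∧ K ∈ stopping halt b) → F K = 0) :
    ∑' K, F K ≤ ∑' Q : stopping halt b, G Q := by
  calc ∑' K, F K ≤ ∑' K, ∑' Q : stopping halt b, (stoppingChildren halt b Q).indicator F K := by
        refine ENNReal.tsum_le_tsum fun K => ?_
        by_cases hK : b < K.scale ∧ K ∈ stopping halt b
        · have hp : b ≤ K.parent.scale := by rw [parent_scale]; omega
          refine le_trans ?_ (ENNReal.le_tsum ⟨own halt b K.parent, (own_spec hp).1⟩)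
          rw [Set.indicator_of_mem]
          exact ⟨hK.1, hK.2, rfl⟩
        · simp [hF K hK]
    _ = ∑' Q : stopping halt b, ∑' K, (stoppingChildren halt b Q).indicator F K :=
        ENNReal.tsum_comm
    _ ≤ _ := by
        refine ENNReal.tsum_le_tsum fun Q => ?_
        rw [← tsum_subtype]
        exact h Q Q.2

end Stopping

end DyadicInterval

/-! ### Averages, Haar coefficients and the Bellman function. -/

namespace DyadicInterval

/-- `x` behaves like the family of averages of a nonnegative function with respect to the
family of masses `p`. -/
structure IsAverage (p x : DyadicInterval → ℝ) : Prop where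
  nonneg : ∀ J, 0 ≤ x J
  add : ∀ J, x J * p J = x J.left * p J.left + x J.right * p J.right

/-- The quantity `m(J)` of a family of masses. -/
noncomputable def branch (p : DyadicInterval → ℝ) (J : DyadicInterval) : ℝ :=
  p J.left * p J.right / p J

/-- The Haar coefficient of a function with averages `x`. -/
noncomputable def coef (p x : DyadicInterval → ℝ) (J : DyadicInterval) : ℝ :=
  √(branch p J) * (x J.left - x J.right)

section

variable {p : DyadicInterval → ℝ}

theorem branch_nonneg (hp : ∀ J, 0 < p J) (J : DyadicInterval) : 0 ≤ branch p J :=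
  div_nonneg (mul_nonneg (hp _).le (hp _).le) (hp _).le

theorem branch_pos (hp : ∀ J, 0 < p J) (J : DyadicInterval) : 0 < branch p J :=
  div_pos (mul_pos (hp _) (hp _)) (hp _)

/-- This comparison turns a factor `m(L)` into the mass of whichever child of `L` stops. -/
theorem branch_le_left (hp : ∀ J, 0 < p J) (hadd : ∀ J, p J = p J.left + p J.right)
    (J : DyadicInterval) : branch p J ≤ p J.left := by
  rw [branch, div_le_iff₀ (hp J), hadd J]
  nlinarith [hp J.left, hp J.right, mul_pos (hp J.left) (hp J.left)]

theorem branch_le_right (hp : ∀ J, 0 < p J) (hadd : ∀ J, p J = p J.left + p J.right)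
    (J : DyadicInterval) : branch p J ≤ p J.right := by
  rw [branch, div_le_iff₀ (hp J), hadd J]
  nlinarith [hp J.left, hp J.right, mul_pos (hp J.right) (hp J.right)]

theorem branch_le_self (hp : ∀ J, 0 < p J) (hadd : ∀ J, p J = p J.left + p J.right)
    (J : DyadicInterval) : branch p J ≤ p J := by
  have := branch_le_left hp hadd J
  have := hadd J
  have := hp J.right
  linarith

/-- The variance identity for a single martingale difference. -/
theorem coef_sq (hp : ∀ J, 0 < p J) (hadd : ∀ J, p J = p J.left + p J.right)
    {x : DyadicInterval → ℝ} (hx : IsAverage p x) (J : DyadicInterval) :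
    coef p x J ^ 2 = x J.left ^ 2 * p J.left + x J.right ^ 2 * p J.right - x J ^ 2 * p J := by
  have h1 := hp J.left
  have h2 := hp J.right
  have h3 := hx.add J
  have h4 := hadd J
  have hxJ : x J = (x J.left * p J.left + x J.right * p J.right) / p J := by
    rw [eq_div_iff (hp J).ne', h3]
  rw [coef, mul_pow, Real.sq_sqrt (branch_nonneg hp J), branch, hxJ, h4]
  have : p J.left + p J.right ≠ 0 := by positivity
  field_simp
  ring

end

/-- The Bellman function estimate at an interval with exactly one stopping child. -/
theorem bellman_one_stop {A x y z p q : ℝ} (hp : 0 < p) (hy : 0 ≤ y) (hz : 0 ≤ z)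
    (hx : 0 ≤ x) (h : x * (p + q) = y * p + z * q) (hxA : x ≤ 4 * A) (hzA : z ≤ 4 * A) :
    z * q * (8 * A - z) ≤ x * (p + q) * (8 * A - x) := by
  -- Discarding the stopped child, of mass `p` and average `y`, frees `8 A y p`. This pays for the
  -- change of the quadratic term, which is at most `(x + z) y p` with `x, z ≤ 4 A`; hence the
  -- constant 8.
  have h1 : (x - z) * q ≤ y * p := by nlinarith [mul_nonneg hx hp.le]
  have h2 : x * (y * p) + z * ((x - z) * q) ≤ 8 * A * (y * p) := by
    have a1 : x * (y * p) ≤ 4 * A * (y * p) := mul_le_mul_of_nonneg_right hxA (by positivity)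
    have a2 : z * ((x - z) * q) ≤ z * (y * p) := mul_le_mul_of_nonneg_left h1 hz
    have a3 : z * (y * p) ≤ 4 * A * (y * p) := mul_le_mul_of_nonneg_right hzA (by positivity)
    linarith
  have h3 : x * (p + q) * (8 * A - x) = 8 * A * (y * p + z * q) - x * (y * p + z * q) := by
    rw [h]; ring
  rw [h3]
  linear_combination h2

/-! ### The square function inside stopping regions. -/

section Core

variable {halt : DyadicInterval → DyadicInterval → Prop} {b : ℤ} {p : DyadicInterval → ℝ}

/-- The averages over the stopping children (in the tree) of `J`. -/
noncomputable def spike (halt : DyadicInterval → DyadicInterval → Prop) (b : ℤ)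
    (x : DyadicInterval → ℝ) (J : DyadicInterval) : ℝ :=
  (stopping halt b).indicator x J.left + (stopping halt b).indicator x J.right

open Classical in
/-- The square of the Haar coefficient at an interval without stopping children, with a weight
that depends on the stopping interval. -/
noncomputable def regular (halt : DyadicInterval → DyadicInterval → Prop) (b : ℤ)
    (p w x : DyadicInterval → ℝ) (J : DyadicInterval) : ℝ :=
  if J.left ∉ stopping halt b ∧ J.right ∉ stopping halt b then
    w (own halt b J) * coef p x J ^ 2 else 0

open Classical in
/-- The contribution of a stopping interval to the sparse form of its stopping parent. -/
noncomputable def contribution (halt : DyadicInterval → DyadicInterval → Prop) (b : ℤ)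
    (p x₁ x₂ : DyadicInterval → ℝ) (K : DyadicInterval) : ℝ :=
  if b < K.scale ∧ K ∈ stopping halt b then
    x₁ (own halt b K.parent) * (x₂ K * p K) + x₂ (own halt b K.parent) * (x₁ K * p K) +
      x₁ (own halt b K.parent) * x₂ (own halt b K.parent) * p K else 0

theorem spike_nonneg {x : DyadicInterval → ℝ} (hx : ∀ J, 0 ≤ x J) (J : DyadicInterval) :
    0 ≤ spike halt b x J :=
  add_nonneg (Set.indicator_nonneg (fun _ _ => hx _) _) (Set.indicator_nonneg (fun _ _ => hx _) _)

theorem contribution_comm (x₁ x₂ : DyadicInterval → ℝ) (K : DyadicInterval) :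
    contribution halt b p x₁ x₂ K = contribution halt b p x₂ x₁ K := by
  unfold contribution
  split_ifs <;> ring

theorem contribution_nonneg (hp : ∀ J, 0 < p J) {x₁ x₂ : DyadicInterval → ℝ}
    (h₁ : ∀ J, 0 ≤ x₁ J) (h₂ : ∀ J, 0 ≤ x₂ J) (K : DyadicInterval) :
    0 ≤ contribution halt b p x₁ x₂ K := by
  unfold contribution
  have a := h₁ K
  have b' := h₂ K
  have c := h₁ (own halt b K.parent)
  have d := h₂ (own halt b K.parent)
  have e := (hp K).le
  split_ifs <;> positivity

/-- The first two summands absorb the average of one function at `K` against the stopping average of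
the other. The third absorbs two stopping averages next to a stopping interval. -/
theorem le_contribution (hp : ∀ J, 0 < p J) {x₁ x₂ : DyadicInterval → ℝ}
    (h₁ : ∀ J, 0 ≤ x₁ J) (h₂ : ∀ J, 0 ≤ x₂ J) {K : DyadicInterval} (hb : b < K.scale)
    (hK : K ∈ stopping halt b) :
    x₁ (own halt b K.parent) * (x₂ K * p K) ≤ contribution halt b p x₁ x₂ K ∧
      x₂ (own halt b K.parent) * (x₁ K * p K) ≤ contribution halt b p x₁ x₂ K ∧
      x₁ (own halt b K.parent) * x₂ (own halt b K.parent) * p K ≤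
        contribution halt b p x₁ x₂ K := by
  rw [contribution, if_pos ⟨hb, hK⟩]
  have a := h₁ K
  have b' := h₂ K
  have c := h₁ (own halt b K.parent)
  have d := h₂ (own halt b K.parent)
  have e := (hp K).le
  have i1 := mul_nonneg c (mul_nonneg b' e)
  have i2 := mul_nonneg d (mul_nonneg a e)
  have i3 := mul_nonneg (mul_nonneg c d) e
  refine ⟨?_, ?_, ?_⟩ <;> linarith

/-- An average is bounded by that of the stopping interval of the parent, unless it stops. -/
theorem le_add_indicator {x : DyadicInterval → ℝ} (hx : ∀ J, 0 ≤ x J)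
    (hc : ∀ J, b ≤ J.scale → x J ≤ 4 * x (own halt b J)) {K : DyadicInterval} (hb : b < K.scale) :
    x K ≤ 4 * x (own halt b K.parent) + (stopping halt b).indicator x K := by
  by_cases hK : K ∈ stopping halt b
  · rw [Set.indicator_of_mem hK]
    have := hx (own halt b K.parent)
    linarith
  · rw [Set.indicator_of_notMem hK, ← own_of_notMem hb hK]
    have := hc K hb.le
    linarith

theorem abs_coef_le {x : DyadicInterval → ℝ} (hx : ∀ J, 0 ≤ x J)
    (hc : ∀ J, b ≤ J.scale → x J ≤ 4 * x (own halt b J)) {J : DyadicInterval} (hb : b ≤ J.scale) :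
    |coef p x J| ≤ √(branch p J) * (4 * x (own halt b J) + spike halt b x J) := by
  rw [coef, abs_mul, abs_of_nonneg (Real.sqrt_nonneg _)]
  refine mul_le_mul_of_nonneg_left ?_ (Real.sqrt_nonneg _)
  have h1 := le_add_indicator hx hc (K := J.left) (by rw [left_scale]; omega)
  have h2 := le_add_indicator hx hc (K := J.right) (by rw [right_scale]; omega)
  rw [left_parent] at h1
  rw [right_parent] at h2
  have h3 := hx J.left
  have h4 := hx J.right
  have h5 : 0 ≤ (stopping halt b).indicator x J.left := Set.indicator_nonneg (fun _ _ => hx _) _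
  have h6 : 0 ≤ (stopping halt b).indicator x J.right := Set.indicator_nonneg (fun _ _ => hx _) _
  rw [spike, abs_le]
  constructor <;> linarith

/-- One step of the Bellman function argument, inside a stopping region. -/
theorem regular_add_le (hp : ∀ J, 0 < p J) (hadd : ∀ J, p J = p J.left + p J.right)
    {x w : DyadicInterval → ℝ} (hx : IsAverage p x) (hw : ∀ J, 0 ≤ w J)
    (hc : ∀ J, b ≤ J.scale → x J ≤ 4 * x (own halt b J))
    {J : DyadicInterval} (hb : b ≤ J.scale) :
    regular halt b p w x J + w (own halt b J) *
      ((stopping halt b)ᶜ.indicator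
          (fun K => x K * p K * (8 * x (own halt b J) - x K)) J.left +
        (stopping halt b)ᶜ.indicator
          (fun K => x K * p K * (8 * x (own halt b J) - x K)) J.right) ≤
      w (own halt b J) * (x J * p J * (8 * x (own halt b J) - x J)) := by
  have hbl : b < J.left.scale := by rw [left_scale]; omega
  have hbr : b < J.right.scale := by rw [right_scale]; omega
  have hcJ := hc J hb
  have hxJ := hx.nonneg J
  by_cases hl : J.left ∈ stopping halt b
  · rw [regular, if_neg (by tauto), Set.indicator_of_notMem (by simpa using hl), zero_add, zero_add]
    refine mul_le_mul_of_nonneg_left ?_ (hw _)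
    by_cases hr : J.right ∈ stopping halt b
    · rw [Set.indicator_of_notMem (by simpa using hr)]
      exact mul_nonneg (mul_nonneg hxJ (hp J).le) (by linarith)
    · rw [Set.indicator_of_mem (by simpa using hr)]
      have h4 := hc J.right hbr.le
      rw [own_of_notMem hbr hr, right_parent] at h4
      have h5 := hx.add J
      rw [hadd J] at h5 ⊢
      exact bellman_one_stop (hp _) (hx.nonneg _) (hx.nonneg _) hxJ h5 hcJ h4
  · have h3 := hc J.left hbl.le
    rw [own_of_notMem hbl hl, left_parent] at h3
    by_cases hr : J.right ∈ stopping halt b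
    · rw [regular, if_neg (by tauto), Set.indicator_of_notMem (a := J.right) (by simpa using hr),
        Set.indicator_of_mem (by simpa using hl), zero_add, add_zero]
      refine mul_le_mul_of_nonneg_left ?_ (hw _)
      have h5 := hx.add J
      rw [hadd J, add_comm (p J.left)] at h5
      rw [hadd J, add_comm (p J.left)]
      exact bellman_one_stop (hp _) (hx.nonneg _) (hx.nonneg _) hxJ
        (by linarith) hcJ h3
    · rw [regular, if_pos ⟨hl, hr⟩, Set.indicator_of_mem (by simpa using hl),
        Set.indicator_of_mem (by simpa using hr), ← mul_add]
      -- With no stopping child the step is an equality: the part linear in the average is additive,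
      -- and the quadratic part loses exactly the squared coefficient.
      refine mul_le_mul_of_nonneg_left (le_of_eq ?_) (hw _)
      rw [coef_sq hp hadd hx]
      have h5 := hx.add J
      linear_combination (-8 * x (own halt b J)) * h5

/-- The regular parts of the Haar coefficients obey the sparse bound. -/
theorem tsum_regular_le (hp : ∀ J, 0 < p J) (hadd : ∀ J, p J = p J.left + p J.right)
    {x w y : DyadicInterval → ℝ} (hx : IsAverage p x) (hw : ∀ J, 0 ≤ w J)
    (hwy : ∀ J, w J * x J ^ 2 ≤ y J)
    (hc : ∀ J, b ≤ J.scale → x J ≤ 4 * x (own halt b J)) :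
    ∑' J, {J | b ≤ J.scale}.indicator (fun J => ENNReal.ofReal (regular halt b p w x J)) J ≤
      8 * ∑' Q : stopping halt b, ENNReal.ofReal (y Q * p Q) := by
  set Ψ : DyadicInterval → ℝ := fun J =>
    w (own halt b J) * (x J * p J * (8 * x (own halt b J) - x J)) with hΨ
  -- Where a new region starts, the average equals `A`, so the potential is `7 w A² p`, covered by
  -- `8 y p`.
  have hN : ∀ K, K ∈ stopping halt b → ENNReal.ofReal (Ψ K) ≤
      (stopping halt b).indicator (fun Q => 8 * ENNReal.ofReal (y Q * p Q)) K := by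
    intro K hK
    rw [Set.indicator_of_mem hK, hΨ]
    simp only [hK.2]
    rw [← ENNReal.ofReal_ofNat 8, ← ENNReal.ofReal_mul (by norm_num)]
    refine ENNReal.ofReal_le_ofReal ?_
    have h1 := mul_le_mul_of_nonneg_right (hwy K) (hp K).le
    have h2 : 0 ≤ w K * x K ^ 2 * p K :=
      mul_nonneg (mul_nonneg (hw K) (sq_nonneg _)) (hp K).le
    linear_combination 8 * h1 + h2
  have hchild : ∀ J K, b < K.scale → K.parent = J → ENNReal.ofReal (Ψ K) ≤
      ENNReal.ofReal (w (own halt b J) * (stopping halt b)ᶜ.indicator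
          (fun K => x K * p K * (8 * x (own halt b J) - x K)) K) +
        (stopping halt b).indicator (fun Q => 8 * ENNReal.ofReal (y Q * p Q)) K := by
    intro J K hb hJ
    by_cases hK : K ∈ stopping halt b
    · exact (hN K hK).trans le_add_self
    · rw [Set.indicator_of_mem (by simpa using hK), Set.indicator_of_notMem hK, add_zero, hΨ]
      simp only [own_of_notMem hb hK, hJ, le_refl]
  rw [← ENNReal.tsum_mul_left, tsum_subtype (stopping halt b)
    (fun Q => 8 * ENNReal.ofReal (y Q * p Q))]
  refine tsum_le_of_telescope b _ (fun J => ENNReal.ofReal (Ψ J)) _ ?_ ?_ ?_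
  · intro J hb
    have h0 := regular_add_le hp hadd hx hw hc hb
    have hbl : b < J.left.scale := by rw [left_scale]; omega
    have hbr : b < J.right.scale := by rw [right_scale]; omega
    have hpos : ∀ K, b < K.scale → K.parent = J → 0 ≤ w (own halt b J) *
        (stopping halt b)ᶜ.indicator (fun K => x K * p K * (8 * x (own halt b J) - x K)) K := by
      intro K hbK hKJ
      refine mul_nonneg (hw _) ?_
      by_cases hK : K ∈ stopping halt b
      · rw [Set.indicator_of_notMem (by simpa using hK)]
      · rw [Set.indicator_of_mem (by simpa using hK)]
        have h4 := hc K hbK.le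
        rw [own_of_notMem hbK hK, hKJ] at h4
        have := hx.nonneg K
        exact mul_nonneg (mul_nonneg this (hp K).le) (by linarith)
    have hreg : 0 ≤ regular halt b p w x J := by
      unfold regular
      split_ifs
      · exact mul_nonneg (hw _) (sq_nonneg _)
      · exact le_rfl
    rw [Set.indicator_of_mem (by exact hb)]
    rw [mul_add] at h0
    have h1 := ENNReal.ofReal_le_ofReal h0
    rw [ENNReal.ofReal_add hreg (add_nonneg (hpos _ hbl (left_parent J))
      (hpos _ hbr (right_parent J))), ENNReal.ofReal_add (hpos _ hbl (left_parent J))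
      (hpos _ hbr (right_parent J))] at h1
    refine (add_le_add_right (add_le_add (hchild J _ hbl (left_parent J))
      (hchild J _ hbr (right_parent J))) _).trans ?_
    rw [add_add_add_comm, ← add_assoc]
    exact add_le_add_left h1 _
  · intro J hb
    rw [Set.indicator_of_notMem]
    simpa using hb
  · intro J hb
    exact hN J ⟨hb.ge, own_of_scale_le hb.le⟩

end Core

end DyadicInterval

/-! ### The pointwise estimate for a pair of siblings. -/

namespace DyadicInterval

section Pointwise

variable {halt : DyadicInterval → DyadicInterval → Prop} {b : ℤ} {p : DyadicInterval → ℝ}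

/-- A spike at `L` against the average of the stopping interval of the sibling `J` of `L`. -/
theorem average_mul_spike_le (hp : ∀ J, 0 < p J) (hadd : ∀ J, p J = p J.left + p J.right)
    {x₁ x₂ : DyadicInterval → ℝ} (h₁ : IsAverage p x₁) (h₂ : IsAverage p x₂)
    {J L : DyadicInterval} (hbJ : b < J.scale) (hbL : b < L.scale) (hJL : J.parent = L.parent)
    {M β : ℝ} (hβ : 0 ≤ β) (hML : M ≤ β * branch p L) :
    M * (x₁ (own halt b J) * spike halt b x₂ L) ≤
      M * ((stopping halt b).indicator x₁ J * spike halt b x₂ L) +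
        β * (contribution halt b p x₁ x₂ L + contribution halt b p x₁ x₂ L.left +
          contribution halt b p x₁ x₂ L.right) := by
  have W := contribution_nonneg (halt := halt) (b := b) hp h₁.nonneg h₂.nonneg
  by_cases hJ : J ∈ stopping halt b
  · rw [Set.indicator_of_mem hJ, hJ.2]
    have := mul_nonneg hβ (add_nonneg (add_nonneg (W L) (W L.left)) (W L.right))
    linarith
  rw [Set.indicator_of_notMem hJ, zero_mul, mul_zero, zero_add, own_of_notMem hbJ hJ, hJL]
  have hx := h₁.nonneg (own halt b L.parent)
  have hspike : M * spike halt b x₂ L ≤ β * ((stopping halt b).indicator x₂ L.left * p L.left +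
      (stopping halt b).indicator x₂ L.right * p L.right) := by
    have i1 : 0 ≤ (stopping halt b).indicator x₂ L.left :=
      Set.indicator_nonneg (fun _ _ => h₂.nonneg _) _
    have i2 : 0 ≤ (stopping halt b).indicator x₂ L.right :=
      Set.indicator_nonneg (fun _ _ => h₂.nonneg _) _
    have m1 := mul_le_mul_of_nonneg_right
      (hML.trans (mul_le_mul_of_nonneg_left (branch_le_left hp hadd L) hβ)) i1
    have m2 := mul_le_mul_of_nonneg_right
      (hML.trans (mul_le_mul_of_nonneg_left (branch_le_right hp hadd L) hβ)) i2
    rw [spike]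
    linarith
  have hmain : x₁ (own halt b L.parent) * ((stopping halt b).indicator x₂ L.left * p L.left +
      (stopping halt b).indicator x₂ L.right * p L.right) ≤
      contribution halt b p x₁ x₂ L + contribution halt b p x₁ x₂ L.left +
          contribution halt b p x₁ x₂ L.right := by
    -- If `L` stops, the masses of `x₂` on its children are charged together to `L`. Otherwise its
    -- stopping children hang directly below the region of the parent and are charged one by one.
    by_cases hL : L ∈ stopping halt b
    · have h := (le_contribution hp h₁.nonneg h₂.nonneg hbL hL).1
      rw [h₂.add L] at h
      have k : ∀ K, (stopping halt b).indicator x₂ K * p K ≤ x₂ K * p K := fun K =>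
        mul_le_mul_of_nonneg_right (Set.indicator_le_self' (fun _ _ => h₂.nonneg _) K) (hp K).le
      have := mul_le_mul_of_nonneg_left (add_le_add (k L.left) (k L.right)) hx
      linarith [W L.left, W L.right]
    · have k : ∀ K, b < K.scale → K.parent = L →
          x₁ (own halt b L.parent) * ((stopping halt b).indicator x₂ K * p K) ≤
            contribution halt b p x₁ x₂ K := by
        intro K hb hK
        by_cases hKs : K ∈ stopping halt b
        · have h := (le_contribution hp h₁.nonneg h₂.nonneg hb hKs).1
          rwa [hK, own_of_notMem hbL hL, ← Set.indicator_of_mem hKs x₂] at h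
        · rw [Set.indicator_of_notMem hKs, zero_mul, mul_zero]
          exact W K
      have kl := k L.left (by rw [left_scale]; omega) (left_parent L)
      have kr := k L.right (by rw [right_scale]; omega) (right_parent L)
      rw [mul_add]
      linarith [W L]
  calc M * (x₁ (own halt b L.parent) * spike halt b x₂ L)
      = x₁ (own halt b L.parent) * (M * spike halt b x₂ L) := by ring
    _ ≤ x₁ (own halt b L.parent) * (β * ((stopping halt b).indicator x₂ L.left * p L.left +
      (stopping halt b).indicator x₂ L.right * p L.right)) := mul_le_mul_of_nonneg_left hspike hx
    _ = β * (x₁ (own halt b L.parent) * ((stopping halt b).indicator x₂ L.left * p L.left +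
      (stopping halt b).indicator x₂ L.right * p L.right)) := by ring
    _ ≤ _ := mul_le_mul_of_nonneg_left hmain hβ

/-- Two averages at siblings, one of which is a stopping interval of larger mass, or the other of
which is not a stopping interval. -/
theorem average_mul_average_le_of_mem (hp : ∀ J, 0 < p J)
    (hadd : ∀ J, p J = p J.left + p J.right)
    {x₁ x₂ : DyadicInterval → ℝ} (h₁ : IsAverage p x₁) (h₂ : IsAverage p x₂)
    (hc : ∀ J, b ≤ J.scale → x₁ J ≤ 4 * x₁ (own halt b J))
    {J L : DyadicInterval} (hbJ : b < J.scale) (hbL : b < L.scale) (hJL : J.parent = L.parent)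
    (hsum : ∀ x, IsAverage p x → x J.parent * p J.parent = x J * p J + x L * p L)
    (hpsum : p J.parent = p J + p L)
    {M β : ℝ} (hβ : 0 ≤ β) (hM : 0 ≤ M) (hML : M ≤ β * branch p L) (hL : L ∈ stopping halt b)
    (h : J ∉ stopping halt b ∨ p L ≤ p J) :
    M * (x₁ (own halt b J) * x₂ L) ≤ 8 * (β * contribution halt b p x₁ x₂ L) := by
  have hW := (le_contribution hp h₁.nonneg h₂.nonneg hbL hL).1
  have hx : x₁ (own halt b J) ≤ 8 * x₁ (own halt b L.parent) := by
    by_cases hJ : J ∈ stopping halt b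
    · have hle := h.resolve_left (not_not.2 hJ)
      rw [hJ.2, ← hJL]
      have h4 := hc J.parent (by rw [parent_scale]; omega)
      have hs := hsum x₁ h₁
      have : x₁ J ≤ 2 * x₁ J.parent := by
        have h5 : 0 ≤ x₁ L * p L := mul_nonneg (h₁.nonneg L) (hp L).le
        have h6 : x₁ J.parent * p J.parent ≤ x₁ J.parent * (2 * p J) :=
          mul_le_mul_of_nonneg_left (by linarith) (h₁.nonneg _)
        refine le_of_mul_le_mul_right ?_ (hp J)
        linarith
      linarith
    · rw [own_of_notMem hbJ hJ, hJL]
      linarith [h₁.nonneg (own halt b L.parent)]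
  have hx2 := h₂.nonneg L
  have hx1 := h₁.nonneg (own halt b L.parent)
  calc M * (x₁ (own halt b J) * x₂ L) ≤ (β * p L) * (8 * x₁ (own halt b L.parent) * x₂ L) := by
        have : M ≤ β * p L := hML.trans (mul_le_mul_of_nonneg_left (branch_le_self hp hadd L) hβ)
        refine mul_le_mul this (mul_le_mul_of_nonneg_right hx hx2)
          (mul_nonneg (h₁.nonneg _) hx2) (hM.trans this)
    _ = 8 * (β * (x₁ (own halt b L.parent) * (x₂ L * p L))) := by ring
    _ ≤ _ := by
        have := mul_le_mul_of_nonneg_left hW hβ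
        linarith

/-- Two averages at siblings that are not stopping intervals, one of which has a stopping
child. -/
theorem average_mul_average_le_of_child (hp : ∀ J, 0 < p J)
    (hadd : ∀ J, p J = p J.left + p J.right)
    {x₁ x₂ : DyadicInterval → ℝ} (h₁ : IsAverage p x₁) (h₂ : IsAverage p x₂)
    {J L : DyadicInterval} (hbL : b < L.scale)
    (hJL : own halt b J = own halt b L)
    {M β : ℝ} (hβ : 0 ≤ β) (hML : M ≤ β * branch p L)
    (h : L.left ∈ stopping halt b ∨ L.right ∈ stopping halt b) :
    M * (x₁ (own halt b J) * x₂ (own halt b L)) ≤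
      β * (contribution halt b p x₁ x₂ L.left + contribution halt b p x₁ x₂ L.right) := by
  have W := contribution_nonneg (halt := halt) (b := b) hp h₁.nonneg h₂.nonneg
  have hx : 0 ≤ x₁ (own halt b L) * x₂ (own halt b L) :=
    mul_nonneg (h₁.nonneg _) (h₂.nonneg _)
  rw [hJL]
  have k : ∀ K, K ∈ stopping halt b → K.parent = L → b < K.scale → branch p L ≤ p K →
      M * (x₁ (own halt b L) * x₂ (own halt b L)) ≤ β * contribution halt b p x₁ x₂ K := by
    intro K hK hKL hb hbr
    have hW := (le_contribution hp h₁.nonneg h₂.nonneg hb hK).2.2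
    rw [hKL] at hW
    calc _ ≤ β * p K * (x₁ (own halt b L) * x₂ (own halt b L)) :=
          mul_le_mul_of_nonneg_right (hML.trans (mul_le_mul_of_nonneg_left hbr hβ)) hx
      _ = β * (x₁ (own halt b L) * x₂ (own halt b L) * p K) := by ring
      _ ≤ _ := mul_le_mul_of_nonneg_left hW hβ
  rcases h with h | h
  · refine (k _ h (left_parent L) (by rw [left_scale]; omega) (branch_le_left hp hadd L)).trans ?_
    exact mul_le_mul_of_nonneg_left (by linarith [W L.right]) hβ
  · refine (k _ h (right_parent L) (by rw [right_scale]; omega)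
      (branch_le_right hp hadd L)).trans ?_
    exact mul_le_mul_of_nonneg_left (by linarith [W L.left]) hβ

/-- The Haar coefficients of a pair of siblings inside a stopping region. -/
theorem abs_coef_mul_coef_le_regular
    {x₁ x₂ : DyadicInterval → ℝ} (h₁ : IsAverage p x₁) (h₂ : IsAverage p x₂)
    (hc₁ : ∀ J, b ≤ J.scale → x₁ J ≤ 4 * x₁ (own halt b J))
    (hc₂ : ∀ J, b ≤ J.scale → x₂ J ≤ 4 * x₂ (own halt b J))
    {J L : DyadicInterval} (hbJ : b < J.scale) (hbL : b < L.scale)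
    (hown : own halt b J = own halt b L)
    (hJ : J.left ∉ stopping halt b ∧ J.right ∉ stopping halt b)
    (hL : L.left ∉ stopping halt b ∧ L.right ∉ stopping halt b) :
    |coef p x₁ J * coef p x₂ L| ≤
      (regular halt b p (fun Q => x₁ Q * x₂ Q / x₁ Q ^ 2) x₁ J +
        regular halt b p (fun Q => x₁ Q * x₂ Q / x₂ Q ^ 2) x₂ L) / 2 := by
  rw [regular, regular, if_pos hJ, if_pos hL, hown]
  set A := x₁ (own halt b L) with hA
  set B := x₂ (own halt b L) with hB
  have hA0 : 0 ≤ A := h₁.nonneg _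
  have hB0 : 0 ≤ B := h₂.nonneg _
  -- A zero stopping average makes the weights degenerate (division by zero gives 0), but then the
  -- coefficient vanishes as well.
  have hz : ∀ x : DyadicInterval → ℝ, IsAverage p x →
      (∀ J, b ≤ J.scale → x J ≤ 4 * x (own halt b J)) → ∀ K, b ≤ K.scale →
      K.left ∉ stopping halt b ∧ K.right ∉ stopping halt b → x (own halt b K) = 0 →
      coef p x K = 0 := by
    intro x hx hc K hb hK h0
    have := abs_coef_le (p := p) hx.nonneg hc hb
    rw [h0, spike, Set.indicator_of_notMem hK.1, Set.indicator_of_notMem hK.2] at this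
    simpa using this
  rcases hA0.eq_or_lt with h | hApos
  · have := hz x₁ h₁ hc₁ J hbJ.le hJ (by rw [hown, ← hA, ← h])
    rw [this, ← h]
    simp
  rcases hB0.eq_or_lt with h | hBpos
  · have := hz x₂ h₂ hc₂ L hbL.le hL (by rw [← hB, ← h])
    rw [this, ← h]
    simp
  generalize coef p x₁ J = s
  generalize coef p x₂ L = t
  have e1 : A * B / A ^ 2 * s ^ 2 + A * B / B ^ 2 * t ^ 2 = B / A * s ^ 2 + A / B * t ^ 2 := by
    field_simp
  have e2 : B / A * s ^ 2 + A / B * t ^ 2 - 2 * |s * t| = A * B * (|s| / A - |t| / B) ^ 2 := by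
    rw [abs_mul, ← sq_abs s, ← sq_abs t]
    field_simp
    ring
  have : 0 ≤ A * B * (|s| / A - |t| / B) ^ 2 := by positivity
  rw [e1]
  linarith

/-- The pointwise estimate behind the sparse bound. -/
theorem abs_coef_mul_coef_le (hp : ∀ J, 0 < p J) (hadd : ∀ J, p J = p J.left + p J.right)
    {x₁ x₂ : DyadicInterval → ℝ} (h₁ : IsAverage p x₁) (h₂ : IsAverage p x₂)
    (hc₁ : ∀ J, b ≤ J.scale → x₁ J ≤ 4 * x₁ (own halt b J))
    (hc₂ : ∀ J, b ≤ J.scale → x₂ J ≤ 4 * x₂ (own halt b J))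
    {β : ℝ} (hβ : 0 ≤ β) (hsib : ∀ J : DyadicInterval, √(branch p J) ≤ β * √(branch p J.sibling))
    {J : DyadicInterval} (hb : b < J.scale) :
    |coef p x₁ J * coef p x₂ J.sibling| ≤
      √(branch p J) * √(branch p J.sibling) * (spike halt b x₁ J * spike halt b x₂ J.sibling) +
      4 * (√(branch p J) * √(branch p J.sibling) *
        ((stopping halt b).indicator x₁ J * spike halt b x₂ J.sibling)) +
      4 * (√(branch p J) * √(branch p J.sibling) *
        ((stopping halt b).indicator x₂ J.sibling * spike halt b x₁ J)) +
      132 * (β * ((contribution halt b p x₁ x₂ J + contribution halt b p x₁ x₂ J.left +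
          contribution halt b p x₁ x₂ J.right) +
        (contribution halt b p x₁ x₂ J.sibling + contribution halt b p x₁ x₂ J.sibling.left +
          contribution halt b p x₁ x₂ J.sibling.right))) +
      (regular halt b p (fun Q => x₁ Q * x₂ Q / x₁ Q ^ 2) x₁ J +
        regular halt b p (fun Q => x₁ Q * x₂ Q / x₂ Q ^ 2) x₂ J.sibling) := by
  set L := J.sibling with hL
  have hbL : b < L.scale := by rw [hL, sibling_scale]; exact hb
  have hJL : J.parent = L.parent := by rw [hL, sibling_parent]
  set M := √(branch p J) * √(branch p L) with hMdef
  have hM : 0 ≤ M := by positivity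
  -- Sibling balance enters the estimate only through this bound and its mirror image `hML`.
  have hMJ : M ≤ β * branch p J := by
    have h := hsib L
    rw [hL, sibling_sibling, ← hL] at h
    calc M ≤ √(branch p J) * (β * √(branch p J)) :=
          mul_le_mul_of_nonneg_left h (Real.sqrt_nonneg _)
      _ = β * (√(branch p J) * √(branch p J)) := by ring
      _ = _ := by rw [Real.mul_self_sqrt (branch_nonneg hp J)]
  have hML : M ≤ β * branch p L := by
    calc M ≤ (β * √(branch p L)) * √(branch p L) :=
          mul_le_mul_of_nonneg_right (hsib J) (Real.sqrt_nonneg _)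
      _ = β * (√(branch p L) * √(branch p L)) := by ring
      _ = _ := by rw [Real.mul_self_sqrt (branch_nonneg hp L)]
  have W := contribution_nonneg (halt := halt) (b := b) hp h₁.nonneg h₂.nonneg
  have hsum : ∀ x, IsAverage p x → x J.parent * p J.parent = x J * p J + x L * p L := by
    intro x hx
    rcases sibling_cases J with ⟨e1, e2⟩ | ⟨e1, e2⟩
    · rw [hx.add, ← e1, ← e2]
    · rw [hx.add, ← e1, ← e2, add_comm]
  have hpsum : p J.parent = p J + p L := by
    rcases sibling_cases J with ⟨e1, e2⟩ | ⟨e1, e2⟩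
    · rw [hadd, ← e1, ← e2]
    · rw [hadd, ← e1, ← e2, add_comm]
  have hsJ := spike_nonneg (halt := halt) (b := b) h₁.nonneg J
  have hsL := spike_nonneg (halt := halt) (b := b) h₂.nonneg L
  have hiJ : 0 ≤ (stopping halt b).indicator x₁ J :=
    Set.indicator_nonneg (fun _ _ => h₁.nonneg _) _
  have hiL : 0 ≤ (stopping halt b).indicator x₂ L :=
    Set.indicator_nonneg (fun _ _ => h₂.nonneg _) _
  have hreg : ∀ x : DyadicInterval → ℝ, ∀ K,
      0 ≤ regular halt b p (fun Q => x₁ Q * x₂ Q / x Q ^ 2) x K := by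
    intro x K
    unfold regular
    split_ifs
    · exact mul_nonneg (div_nonneg (mul_nonneg (h₁.nonneg _) (h₂.nonneg _)) (sq_nonneg _))
        (sq_nonneg _)
    · exact le_rfl
  have hWs : 0 ≤ β * ((contribution halt b p x₁ x₂ J + contribution halt b p x₁ x₂ J.left +
          contribution halt b p x₁ x₂ J.right) + (contribution halt b p x₁ x₂ L +
          contribution halt b p x₁ x₂ L.left + contribution halt b p x₁ x₂ L.right)) := by
    have := W J; have := W J.left; have := W J.right
    have := W L; have := W L.left; have := W L.right
    positivity
  have hss : 0 ≤ M * (spike halt b x₁ J * spike halt b x₂ L) := by positivity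
  have his : 0 ≤ M * ((stopping halt b).indicator x₁ J * spike halt b x₂ L) := by positivity
  have hsi : 0 ≤ M * ((stopping halt b).indicator x₂ L * spike halt b x₁ J) := by positivity
  have hR₁ := hreg x₁ J
  have hR₂ := hreg x₂ L
  -- Outside this regular case one of `J`, `L` or their children stops: if neither sibling stops,
  -- both inherit the stopping interval of their common parent.
  by_cases hr : own halt b J = own halt b L ∧
      (J.left ∉ stopping halt b ∧ J.right ∉ stopping halt b) ∧
      (L.left ∉ stopping halt b ∧ L.right ∉ stopping halt b)
  · have := abs_coef_mul_coef_le_regular h₁ h₂ hc₁ hc₂ hb hbL hr.1 hr.2.1 hr.2.2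
    linarith
  -- the product of the two averages
  have hcc : M * (x₁ (own halt b J) * x₂ (own halt b L)) ≤
      8 * (β * ((contribution halt b p x₁ x₂ J + contribution halt b p x₁ x₂ J.left +
          contribution halt b p x₁ x₂ J.right) + (contribution halt b p x₁ x₂ L +
          contribution halt b p x₁ x₂ L.left + contribution halt b p x₁ x₂ L.right))) := by
    have n1 := mul_nonneg hβ (W J)
    have n2 := mul_nonneg hβ (W J.left)
    have n3 := mul_nonneg hβ (W J.right)
    have n4 := mul_nonneg hβ (W L)
    have n5 := mul_nonneg hβ (W L.left)
    have n6 := mul_nonneg hβ (W L.right)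
    have useL : L ∈ stopping halt b → (J ∉ stopping halt b ∨ p L ≤ p J) →
        M * (x₁ (own halt b J) * x₂ (own halt b L)) ≤
          8 * (β * contribution halt b p x₁ x₂ L) := by
      intro hLs h
      rw [hLs.2]
      exact average_mul_average_le_of_mem hp hadd h₁ h₂ hc₁ hb hbL hJL hsum hpsum hβ hM hML hLs h
    have useJ : J ∈ stopping halt b → (L ∉ stopping halt b ∨ p J ≤ p L) →
        M * (x₁ (own halt b J) * x₂ (own halt b L)) ≤
          8 * (β * contribution halt b p x₁ x₂ J) := by
      intro hJs h
      rw [hJs.2, contribution_comm, mul_comm (x₁ J)]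
      refine average_mul_average_le_of_mem hp hadd h₂ h₁ hc₂ hbL hb hJL.symm ?_ ?_ hβ hM hMJ hJs h
      · intro x hx
        rw [← hJL, hsum x hx, add_comm]
      · rw [← hJL, hpsum, add_comm]
    by_cases hJs : J ∈ stopping halt b
    · by_cases hLs : L ∈ stopping halt b
      · rcases le_total (p L) (p J) with h | h
        · linarith [useL hLs (.inr h)]
        · linarith [useJ hJs (.inr h)]
      · linarith [useJ hJs (.inl hLs)]
    · by_cases hLs : L ∈ stopping halt b
      · linarith [useL hLs (.inl hJs)]
      · have hown : own halt b J = own halt b L := by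
          rw [own_of_notMem hb hJs, own_of_notMem hbL hLs, hJL]
        by_cases hJc : J.left ∈ stopping halt b ∨ J.right ∈ stopping halt b
        · have := average_mul_average_le_of_child hp hadd h₂ h₁ hb hown.symm hβ hMJ hJc
          rw [contribution_comm, contribution_comm x₂, mul_comm (x₂ _)] at this
          linarith
        · have hLc : L.left ∈ stopping halt b ∨ L.right ∈ stopping halt b := by tauto
          have := average_mul_average_le_of_child hp hadd h₁ h₂ hbL hown hβ hML hLc
          linarith
  have hcs := average_mul_spike_le (halt := halt) hp hadd h₁ h₂ hb hbL hJL hβ hML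
  have hsc := average_mul_spike_le (halt := halt) hp hadd h₂ h₁ hbL hb hJL.symm hβ hMJ
  rw [contribution_comm, contribution_comm x₂, contribution_comm x₂ x₁ J.right] at hsc
  have hprod : |coef p x₁ J * coef p x₂ L| ≤
      M * ((4 * x₁ (own halt b J) + spike halt b x₁ J) *
        (4 * x₂ (own halt b L) + spike halt b x₂ L)) := by
    rw [abs_mul]
    refine (mul_le_mul (abs_coef_le h₁.nonneg hc₁ hb.le) (abs_coef_le h₂.nonneg hc₂ hbL.le)
      (abs_nonneg _) ?_).trans_eq ?_
    · have := h₁.nonneg (own halt b J)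
      positivity
    · rw [hMdef]; ring
  have n : 0 ≤ β * (contribution halt b p x₁ x₂ J + contribution halt b p x₁ x₂ J.left +
          contribution halt b p x₁ x₂ J.right) :=
    mul_nonneg hβ (add_nonneg (add_nonneg (W _) (W _)) (W _))
  have n' : 0 ≤ β * (contribution halt b p x₁ x₂ L + contribution halt b p x₁ x₂ L.left +
          contribution halt b p x₁ x₂ L.right) :=
    mul_nonneg hβ (add_nonneg (add_nonneg (W _) (W _)) (W _))
  rw [mul_add β] at hcc ⊢
  -- The constant 132 is `16 · 8` from the product of the stopping averages plus 4 from the mixed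
  -- products.
  linarith only [hprod, hcc, hcs, hsc, hR₁, hR₂, hss, his, hsi, n, n']

end Pointwise

end DyadicInterval

/-! ### Summation over the tree. -/

namespace DyadicInterval

section Sum

variable {halt : DyadicInterval → DyadicInterval → Prop} {b : ℤ} {p : DyadicInterval → ℝ}

/-- Below a fixed `Q` the stopping averages are constants, and packing for `ν₂`, `ν₁` and `μ` bounds
each of the three summands by `x₁ Q * x₂ Q * p Q`. -/
theorem tsum_contribution_le {μ ν₁ ν₂ : Measure ℝ} (hp : ∀ J, 0 < p J)
    {x₁ x₂ : DyadicInterval → ℝ} (h₁ : ∀ J, 0 ≤ x₁ J) (h₂ : ∀ J, 0 ≤ x₂ J)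
    (hμ : ∀ J, μ J.toSet = ENNReal.ofReal (p J))
    (hν₁ : ∀ J, ν₁ J.toSet = ENNReal.ofReal (x₁ J * p J))
    (hν₂ : ∀ J, ν₂ J.toSet = ENNReal.ofReal (x₂ J * p J)) :
    ∑' K, ENNReal.ofReal (contribution halt b p x₁ x₂ K) ≤
      3 * ∑' Q : stopping halt b, ENNReal.ofReal (x₁ Q * x₂ Q * p Q) := by
  rw [← ENNReal.tsum_mul_left]
  refine tsum_stopping_le _ (fun Q => 3 * ENNReal.ofReal (x₁ Q * x₂ Q * p Q)) ?_ ?_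
  · intro Q _
    have e : ∀ K : stoppingChildren halt b Q,
        ENNReal.ofReal (contribution halt b p x₁ x₂ K) =
          ENNReal.ofReal (x₁ Q) * ν₂ (K : DyadicInterval).toSet +
          ENNReal.ofReal (x₂ Q) * ν₁ (K : DyadicInterval).toSet +
          ENNReal.ofReal (x₁ Q * x₂ Q) * μ (K : DyadicInterval).toSet := by
      rintro ⟨K, hK⟩
      have hpK := (hp K).le
      have h1K := h₁ K
      have h2K := h₂ K
      have h1Q := h₁ Q
      have h2Q := h₂ Q
      simp only
      rw [contribution, if_pos ⟨hK.1, hK.2.1⟩, hK.2.2, hμ, hν₁, hν₂, ← ENNReal.ofReal_mul h1Q,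
        ← ENNReal.ofReal_mul h2Q, ← ENNReal.ofReal_mul (by positivity),
        ← ENNReal.ofReal_add (by positivity) (by positivity),
        ← ENNReal.ofReal_add (by positivity) (by positivity)]
    rw [tsum_congr e, ENNReal.tsum_add, ENNReal.tsum_add, ENNReal.tsum_mul_left,
      ENNReal.tsum_mul_left, ENNReal.tsum_mul_left]
    refine (add_le_add (add_le_add
      (mul_le_mul_right (tsum_stoppingChildren_le ν₂ Q) _)
      (mul_le_mul_right (tsum_stoppingChildren_le ν₁ Q) _))
      (mul_le_mul_right (tsum_stoppingChildren_le μ Q) _)).trans_eq ?_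
    have hpQ := (hp Q).le
    have h1Q := h₁ Q
    have h2Q := h₂ Q
    rw [hμ, hν₁, hν₂, ← ENNReal.ofReal_mul h1Q, ← ENNReal.ofReal_mul h2Q,
      ← ENNReal.ofReal_mul (by positivity), ← ENNReal.ofReal_add (by positivity) (by positivity),
      ← ENNReal.ofReal_add (by positivity) (by positivity), ← ENNReal.ofReal_ofNat 3,
      ← ENNReal.ofReal_mul (by norm_num)]
    congr 1
    ring
  · intro K hK
    rw [contribution, if_neg hK, ENNReal.ofReal_zero]

theorem tsum_le_tsum_subtype {α : Type*} {P : Set α} {g : α → ℝ≥0∞}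
    {φ : DyadicInterval → α} (hφ : Function.Injective φ) {f : DyadicInterval → ℝ≥0∞}
    (h : ∀ J, f J ≤ P.indicator g (φ J)) : ∑' J, f J ≤ ∑' q : P, g q := by
  rw [tsum_subtype]
  exact (ENNReal.tsum_le_tsum h).trans (ENNReal.tsum_comp_le_tsum_of_injective hφ _)

/-- The form associated with pairs of cousins. -/
noncomputable def cousinForm (S : Set DyadicInterval) (p x₁ x₂ : DyadicInterval → ℝ) : ℝ≥0∞ :=
  ∑' q : {q : DyadicInterval × DyadicInterval |
      q.1 ∈ S ∧ q.2 ∈ S ∧ q.1.parent = q.2.parent.sibling},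
    ENNReal.ofReal (x₁ q.1.1 * x₂ q.1.2 *
      √(branch p q.1.1.parent) * √(branch p q.1.2.parent))

/-- The form associated with pairs of a nephew and an uncle; the first function is evaluated at the
uncle. -/
noncomputable def uncleForm (S : Set DyadicInterval) (p x₁ x₂ : DyadicInterval → ℝ) : ℝ≥0∞ :=
  ∑' q : {q : DyadicInterval × DyadicInterval |
      q.1 ∈ S ∧ q.2 ∈ S ∧ q.1 = q.2.parent.sibling},
    ENNReal.ofReal (x₁ q.1.1 * x₂ q.1.2 *
      √(branch p q.1.1) * √(branch p q.1.2.parent))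

/-- Each choice of a child of `J` and a child of its sibling maps `J` injectively to a pair of
cousins; there are four choices. -/
theorem tsum_spike_mul_spike_le {x₁ x₂ : DyadicInterval → ℝ}
    (h₁ : ∀ J, 0 ≤ x₁ J) (h₂ : ∀ J, 0 ≤ x₂ J) :
    ∑' J : DyadicInterval, ENNReal.ofReal (√(branch p J) * √(branch p J.sibling) *
      (spike halt b x₁ J * spike halt b x₂ J.sibling)) ≤
      4 * cousinForm (stopping halt b) p x₁ x₂ := by
  have key : ∀ c c' : DyadicInterval → DyadicInterval, Function.Injective c →
      (∀ J, (c J).parent = J) → (∀ J, (c' J).parent = J) →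
      ∑' J : DyadicInterval, ENNReal.ofReal (√(branch p J) * √(branch p J.sibling) *
        ((stopping halt b).indicator x₁ (c J) * (stopping halt b).indicator x₂ (c' J.sibling))) ≤
        cousinForm (stopping halt b) p x₁ x₂ := by
    intro c c' hc hcp hcp'
    refine tsum_le_tsum_subtype (P := {q : DyadicInterval × DyadicInterval |
      q.1 ∈ stopping halt b ∧ q.2 ∈ stopping halt b ∧ q.1.parent = q.2.parent.sibling})
      (g := fun q => ENNReal.ofReal (x₁ q.1 * x₂ q.2 *
        √(branch p q.1.parent) * √(branch p q.2.parent)))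
      (φ := fun J => (c J, c' J.sibling)) (fun J K h => hc (congrArg Prod.fst h)) fun J => ?_
    by_cases h : c J ∈ stopping halt b ∧ c' J.sibling ∈ stopping halt b
    · rw [Set.indicator_of_mem h.1, Set.indicator_of_mem h.2,
        Set.indicator_of_mem (by exact ⟨h.1, h.2, by simp only [hcp, hcp', sibling_sibling]⟩)]
      simp only [hcp, hcp']
      refine ENNReal.ofReal_le_ofReal (le_of_eq ?_)
      ring
    · rcases not_and_or.1 h with h | h
      · simp [Set.indicator_of_notMem h]
      · simp [Set.indicator_of_notMem h]
  have i1 : ∀ K, 0 ≤ (stopping halt b).indicator x₁ K :=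
    Set.indicator_nonneg (fun _ _ => h₁ _)
  have i2 : ∀ K, 0 ≤ (stopping halt b).indicator x₂ K :=
    Set.indicator_nonneg (fun _ _ => h₂ _)
  have e : ∀ J : DyadicInterval, ENNReal.ofReal (√(branch p J) * √(branch p J.sibling) *
      (spike halt b x₁ J * spike halt b x₂ J.sibling)) ≤
      ((_ + _) + (_ + _)) := fun J => by
    rw [spike, spike, add_mul, mul_add, mul_add, mul_add, mul_add, mul_add]
    exact ENNReal.ofReal_add_le.trans (add_le_add ENNReal.ofReal_add_le ENNReal.ofReal_add_le)
  refine (ENNReal.tsum_le_tsum e).trans ?_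
  rw [ENNReal.tsum_add, ENNReal.tsum_add, ENNReal.tsum_add]
  refine (add_le_add
    (add_le_add (key left left left_injective left_parent left_parent)
      (key left right left_injective left_parent right_parent))
    (add_le_add (key right left right_injective right_parent left_parent)
      (key right right right_injective right_parent right_parent))).trans_eq ?_
  ring

theorem tsum_indicator_mul_spike_le {x₁ x₂ : DyadicInterval → ℝ} :
    ∑' J : DyadicInterval, ENNReal.ofReal (√(branch p J) * √(branch p J.sibling) *
      ((stopping halt b).indicator x₁ J * spike halt b x₂ J.sibling)) ≤
      2 * uncleForm (stopping halt b) p x₁ x₂ := by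
  have key : ∀ c : DyadicInterval → DyadicInterval, (∀ J, (c J).parent = J) →
      ∑' J : DyadicInterval, ENNReal.ofReal (√(branch p J) * √(branch p J.sibling) *
        ((stopping halt b).indicator x₁ J * (stopping halt b).indicator x₂ (c J.sibling))) ≤
        uncleForm (stopping halt b) p x₁ x₂ := by
    intro c hcp
    refine tsum_le_tsum_subtype (P := {q : DyadicInterval × DyadicInterval |
      q.1 ∈ stopping halt b ∧ q.2 ∈ stopping halt b ∧ q.1 = q.2.parent.sibling})
      (g := fun q => ENNReal.ofReal (x₁ q.1 * x₂ q.2 *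
        √(branch p q.1) * √(branch p q.2.parent)))
      (φ := fun J => (J, c J.sibling)) (fun J K h => congrArg Prod.fst h) fun J => ?_
    by_cases h : J ∈ stopping halt b ∧ c J.sibling ∈ stopping halt b
    · rw [Set.indicator_of_mem h.1, Set.indicator_of_mem h.2,
        Set.indicator_of_mem (by exact ⟨h.1, h.2, by simp only [hcp, sibling_sibling]⟩)]
      simp only [hcp]
      refine ENNReal.ofReal_le_ofReal (le_of_eq ?_)
      ring
    · rcases not_and_or.1 h with h | h
      · simp [Set.indicator_of_notMem h]
      · simp [Set.indicator_of_notMem h]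
  have e : ∀ J : DyadicInterval, ENNReal.ofReal (√(branch p J) * √(branch p J.sibling) *
      ((stopping halt b).indicator x₁ J * spike halt b x₂ J.sibling)) ≤ _ + _ := fun J => by
    rw [spike, mul_add, mul_add]
    exact ENNReal.ofReal_add_le
  refine (ENNReal.tsum_le_tsum e).trans ?_
  rw [ENNReal.tsum_add, two_mul]
  exact add_le_add (key left left_parent) (key right right_parent)

/-- The sparse bound for the sum over all scales finer than `b`. -/
theorem tsum_coef_mul_coef_le {μ ν₁ ν₂ : Measure ℝ} (hp : ∀ J, 0 < p J)
    (hadd : ∀ J, p J = p J.left + p J.right)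
    {x₁ x₂ : DyadicInterval → ℝ} (h₁ : IsAverage p x₁) (h₂ : IsAverage p x₂)
    (hμ : ∀ J, μ J.toSet = ENNReal.ofReal (p J))
    (hν₁ : ∀ J, ν₁ J.toSet = ENNReal.ofReal (x₁ J * p J))
    (hν₂ : ∀ J, ν₂ J.toSet = ENNReal.ofReal (x₂ J * p J))
    (hc₁ : ∀ J, b ≤ J.scale → x₁ J ≤ 4 * x₁ (own halt b J))
    (hc₂ : ∀ J, b ≤ J.scale → x₂ J ≤ 4 * x₂ (own halt b J))
    {β : ℝ} (hβ : 1 ≤ β) (hsib : ∀ J : DyadicInterval, √(branch p J) ≤ β * √(branch p J.sibling)) :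
    ∑' J : DyadicInterval, {J | b < J.scale}.indicator
        (fun J => ENNReal.ofReal |coef p x₁ J * coef p x₂ J.sibling|) J ≤
      2392 * (ENNReal.ofReal β *
          ∑' Q : stopping halt b, ENNReal.ofReal (x₁ Q * x₂ Q * p Q) +
        (cousinForm (stopping halt b) p x₁ x₂ + uncleForm (stopping halt b) p x₁ x₂ +
          uncleForm (stopping halt b) p x₂ x₁)) := by
  set A := ∑' Q : stopping halt b, ENNReal.ofReal (x₁ Q * x₂ Q * p Q) with hA
  set W : DyadicInterval → ℝ≥0∞ := fun K => ENNReal.ofReal (contribution halt b p x₁ x₂ K) with hW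
  have hβ0 : 0 ≤ β := zero_le_one.trans hβ
  set R : (DyadicInterval → ℝ) → DyadicInterval → ℝ≥0∞ := fun x =>
    {J | b ≤ J.scale}.indicator fun J =>
      ENNReal.ofReal (regular halt b p (fun Q => x₁ Q * x₂ Q / x Q ^ 2) x J) with hR
  have hpt : ∀ J : DyadicInterval, {J | b < J.scale}.indicator
      (fun J => ENNReal.ofReal |coef p x₁ J * coef p x₂ J.sibling|) J ≤
      ENNReal.ofReal (√(branch p J) * √(branch p J.sibling) *
        (spike halt b x₁ J * spike halt b x₂ J.sibling)) +
      4 * ENNReal.ofReal (√(branch p J) * √(branch p J.sibling) *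
        ((stopping halt b).indicator x₁ J * spike halt b x₂ J.sibling)) +
      4 * ENNReal.ofReal (√(branch p J) * √(branch p J.sibling) *
        ((stopping halt b).indicator x₂ J.sibling * spike halt b x₁ J)) +
      132 * (ENNReal.ofReal β * ((W J + W J.left + W J.right) +
        (W J.sibling + W J.sibling.left + W J.sibling.right))) +
      (R x₁ J + R x₂ J.sibling) := by
    intro J
    by_cases hb : b < J.scale
    · rw [Set.indicator_of_mem (by exact hb)]
      refine (ENNReal.ofReal_le_ofReal
        (abs_coef_mul_coef_le hp hadd h₁ h₂ hc₁ hc₂ hβ0 hsib hb)).trans ?_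
      refine ENNReal.ofReal_add_le.trans (add_le_add ?_ ?_)
      · refine ENNReal.ofReal_add_le.trans (add_le_add ?_ ?_)
        · refine ENNReal.ofReal_add_le.trans (add_le_add ?_ ?_)
          · refine ENNReal.ofReal_add_le.trans (add_le_add le_rfl ?_)
            rw [ENNReal.ofReal_mul (by norm_num), ENNReal.ofReal_ofNat]
          · rw [ENNReal.ofReal_mul (by norm_num), ENNReal.ofReal_ofNat]
        · rw [ENNReal.ofReal_mul (by norm_num), ENNReal.ofReal_ofNat, ENNReal.ofReal_mul hβ0]
          gcongr
          refine ENNReal.ofReal_add_le.trans (add_le_add ?_ ?_)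
          · exact ENNReal.ofReal_add_le.trans (add_le_add ENNReal.ofReal_add_le le_rfl)
          · exact ENNReal.ofReal_add_le.trans (add_le_add ENNReal.ofReal_add_le le_rfl)
      · refine ENNReal.ofReal_add_le.trans (add_le_add ?_ ?_)
        · simp only [hR]
          rw [Set.indicator_of_mem (show J ∈ {J : DyadicInterval | b ≤ J.scale} from hb.le)]
        · simp only [hR]
          rw [Set.indicator_of_mem
            (show J.sibling ∈ {J : DyadicInterval | b ≤ J.scale} from hb.le)]
    · rw [Set.indicator_of_notMem (by exact hb)]
      exact zero_le
  refine (ENNReal.tsum_le_tsum hpt).trans ?_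
  simp only [ENNReal.tsum_add, ENNReal.tsum_mul_left]
  have hWA : ∑' K, W K ≤ 3 * A :=
    tsum_contribution_le hp h₁.nonneg h₂.nonneg hμ hν₁ hν₂
  have hWφ : ∀ φ : DyadicInterval → DyadicInterval, Function.Injective φ →
      ∑' K, W (φ K) ≤ 3 * A := fun φ hφ =>
    (ENNReal.tsum_comp_le_tsum_of_injective hφ W).trans hWA
  have hRx : ∀ x, IsAverage p x → (∀ J, b ≤ J.scale → x J ≤ 4 * x (own halt b J)) →
      ∑' J, R x J ≤ 8 * A := by
    intro x hx hc
    refine tsum_regular_le hp hadd hx (y := fun Q => x₁ Q * x₂ Q) ?_ ?_ hc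
    · exact fun Q => div_nonneg (mul_nonneg (h₁.nonneg _) (h₂.nonneg _)) (sq_nonneg _)
    · intro Q
      have : 0 ≤ x₁ Q * x₂ Q := mul_nonneg (h₁.nonneg _) (h₂.nonneg _)
      rcases eq_or_ne (x Q) 0 with h | h
      · simpa [h] using this
      · exact (div_mul_cancel₀ _ (pow_ne_zero 2 h)).le
  have hR2 : ∑' J : DyadicInterval, R x₂ J.sibling ≤ 8 * A :=
    (ENNReal.tsum_comp_le_tsum_of_injective sibling_injective (R x₂)).trans (hRx x₂ h₂ hc₂)
  have hsp : ∑' J : DyadicInterval, ENNReal.ofReal (√(branch p J) * √(branch p J.sibling) *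
        ((stopping halt b).indicator x₂ J.sibling * spike halt b x₁ J)) ≤
      2 * uncleForm (stopping halt b) p x₂ x₁ := by
    refine le_trans ?_ tsum_indicator_mul_spike_le
    refine le_trans (le_of_eq ?_) (ENNReal.tsum_comp_le_tsum_of_injective sibling_injective _)
    refine tsum_congr fun J => ?_
    rw [sibling_sibling, mul_comm (√(branch p J))]
  -- The regular part carries no balance factor, and is absorbed since `1 ≤ β`.
  have hβA : A ≤ ENNReal.ofReal β * A := by
    conv_lhs => rw [← one_mul A]
    gcongr
    rwa [ENNReal.one_le_ofReal]
  calc _ ≤ 4 * cousinForm (stopping halt b) p x₁ x₂ +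
        4 * (2 * uncleForm (stopping halt b) p x₁ x₂) +
        4 * (2 * uncleForm (stopping halt b) p x₂ x₁) +
        132 * (ENNReal.ofReal β * ((3 * A + 3 * A + 3 * A) + (3 * A + 3 * A + 3 * A))) +
        (8 * (ENNReal.ofReal β * A) + 8 * (ENNReal.ofReal β * A)) := by
        gcongr
        · exact tsum_spike_mul_spike_le h₁.nonneg h₂.nonneg
        · exact tsum_indicator_mul_spike_le
        · exact hWφ _ left_injective
        · exact hWφ _ right_injective
        · exact hWφ _ sibling_injective
        · exact hWφ _ (left_injective.comp sibling_injective)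
        · exact hWφ _ (right_injective.comp sibling_injective)
        · exact (hRx x₁ h₁ hc₁).trans (by gcongr)
        · exact hR2.trans (by gcongr)
    -- `2392 = 132 · 18 + 8 + 8`: six sums of contributions at `3A` each, and two regular sums.
    _ = 2392 * (ENNReal.ofReal β * A) + (4 * cousinForm (stopping halt b) p x₁ x₂ +
        8 * uncleForm (stopping halt b) p x₁ x₂ + 8 * uncleForm (stopping halt b) p x₂ x₁) := by
        ring
    _ ≤ 2392 * (ENNReal.ofReal β * A) + (2392 * cousinForm (stopping halt b) p x₁ x₂ +
        2392 * uncleForm (stopping halt b) p x₁ x₂ +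
        2392 * uncleForm (stopping halt b) p x₂ x₁) := by
        gcongr <;> norm_num
    _ = _ := by ring

end Sum

end DyadicInterval

/-! ### The stopping rule and the truncation in scale. -/

namespace DyadicInterval

section Stop

variable {halt : DyadicInterval → DyadicInterval → Prop} {b : ℤ}

theorem stop_of_mem_stoppingChildren {Q K : DyadicInterval}
    (hK : K ∈ stoppingChildren halt b Q) : halt Q K := by
  obtain ⟨h1, h2, h3⟩ := hK
  by_contra h
  have h4 := own_of_not_stop h1 (by rwa [h3])
  have h5 := (own_spec (halt := halt) (b := b) (J := K.parent) (by rw [parent_scale]; omega)).2.2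
  rw [← h4, h2.2, parent_scale] at h5
  omega

theorem le_four_mul_own {x : DyadicInterval → ℝ} (hx : ∀ J, 0 ≤ x J)
    (h : ∀ Q K, ¬ halt Q K → x K ≤ 4 * x Q) (J : DyadicInterval) (hb : b ≤ J.scale) :
    x J ≤ 4 * x (own halt b J) := by
  have self : x J ≤ 4 * x J := by linarith [hx J]
  rcases hb.eq_or_lt with hb | hb
  · rwa [own_of_scale_le hb.ge]
  · by_cases hs : halt (own halt b J.parent) J
    · rwa [own_of_stop hb hs]
    · rw [own_of_not_stop hb hs]
      exact h _ _ hs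

end Stop

/-- The stopping condition: one of the averages is more than four times as large. -/
def jump (x₁ x₂ : DyadicInterval → ℝ) (Q K : DyadicInterval) : Prop :=
  4 * x₁ Q < x₁ K ∨ 4 * x₂ Q < x₂ K

/-- Chebyshev: the children stopped by one given function have total mass at most a quarter of that
of `Q`. -/
theorem tsum_stoppingChildren_jump_le {μ ν₁ ν₂ : Measure ℝ} {p x₁ x₂ : DyadicInterval → ℝ} {b : ℤ}
    (hp : ∀ J, 0 < p J) (h₁ : ∀ J, 0 ≤ x₁ J) (h₂ : ∀ J, 0 ≤ x₂ J)
    (hμ : ∀ J, μ J.toSet = ENNReal.ofReal (p J))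
    (hν₁ : ∀ J, ν₁ J.toSet = ENNReal.ofReal (x₁ J * p J))
    (hν₂ : ∀ J, ν₂ J.toSet = ENNReal.ofReal (x₂ J * p J)) (Q : DyadicInterval) :
    ∑' K : stoppingChildren (jump x₁ x₂) b Q, μ (K : DyadicInterval).toSet ≤ μ Q.toSet / 2 := by
  have single : ∀ {x : DyadicInterval → ℝ} {ν : Measure ℝ}, (∀ J, 0 ≤ x J) →
      (∀ J, ν J.toSet = ENNReal.ofReal (x J * p J)) → ∀ K, 4 * x Q < x K →
      μ K.toSet ≤ (ENNReal.ofReal (4 * x Q))⁻¹ * ν K.toSet := by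
    intro x ν hx hν K hK
    have hxK : 0 < x K := by linarith [hx Q]
    rw [mul_comm, ← div_eq_mul_inv, ENNReal.le_div_iff_mul_le, hμ, hν, mul_comm,
      ← ENNReal.ofReal_mul (by linarith [hx Q])]
    · exact ENNReal.ofReal_le_ofReal (mul_le_mul_of_nonneg_right hK.le (hp K).le)
    -- When `x Q = 0` the inverse is `∞`, and the bound survives because `ν K.toSet` is positive.
    · right
      rw [hν, ← pos_iff_ne_zero, ENNReal.ofReal_pos]
      exact mul_pos hxK (hp K)
    · left
      exact ENNReal.ofReal_ne_top
  have total : ∀ {x : DyadicInterval → ℝ} {ν : Measure ℝ}, (∀ J, 0 ≤ x J) →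
      (∀ J, ν J.toSet = ENNReal.ofReal (x J * p J)) →
      ∑' K : stoppingChildren (jump x₁ x₂) b Q,
        (ENNReal.ofReal (4 * x Q))⁻¹ * ν (K : DyadicInterval).toSet ≤
      ENNReal.ofReal (p Q / 4) := by
    intro x ν hx hν
    rw [ENNReal.tsum_mul_left]
    refine (mul_le_mul_right (tsum_stoppingChildren_le ν Q) _).trans ?_
    rw [mul_comm, ← div_eq_mul_inv]
    refine ENNReal.div_le_of_le_mul ?_
    rw [hν, ← ENNReal.ofReal_mul (by linarith [hp Q])]
    refine ENNReal.ofReal_le_ofReal (le_of_eq ?_)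
    ring
  calc ∑' K : stoppingChildren (jump x₁ x₂) b Q, μ (K : DyadicInterval).toSet
      ≤ ∑' K : stoppingChildren (jump x₁ x₂) b Q,
        ((ENNReal.ofReal (4 * x₁ Q))⁻¹ * ν₁ (K : DyadicInterval).toSet +
          (ENNReal.ofReal (4 * x₂ Q))⁻¹ * ν₂ (K : DyadicInterval).toSet) := by
        refine ENNReal.tsum_le_tsum fun K => ?_
        rcases stop_of_mem_stoppingChildren K.2 with h | h
        · exact (single h₁ hν₁ K h).trans le_self_add
        · exact (single h₂ hν₂ K h).trans le_add_self
    _ ≤ ENNReal.ofReal (p Q / 4) + ENNReal.ofReal (p Q / 4) := by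
        rw [ENNReal.tsum_add]
        exact add_le_add (total h₁ hν₁) (total h₂ hν₂)
    _ = μ Q.toSet / 2 := by
        have := hp Q
        rw [hμ, ← ENNReal.ofReal_add (by positivity) (by positivity), ← ENNReal.ofReal_ofNat 2,
          ← ENNReal.ofReal_div_of_pos two_pos]
        congr 1
        ring

/-- Half of a finite sum is attained over the scales finer than some `b`. -/
theorem exists_tsum_le_two_mul (T : DyadicInterval → ℝ≥0∞) (hT : ∑' J, T J ≠ ∞) :
    ∃ b : ℤ, ∑' J, T J ≤ 2 * ∑' J, {J : DyadicInterval | b < J.scale}.indicator T J := by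
  rcases eq_or_ne (∑' J, T J) 0 with h0 | h0
  · exact ⟨0, by simp [h0]⟩
  have hlt : (∑' J, T J) / 2 < ∑' J, T J := ENNReal.half_lt_self h0 hT
  rw [ENNReal.tsum_eq_iSup_sum (f := T)] at hlt
  obtain ⟨s, hs⟩ := lt_iSup_iff.1 hlt
  rw [← ENNReal.tsum_eq_iSup_sum] at hs
  obtain ⟨c, hc⟩ := (s.image scale).bddBelow
  -- Only scales strictly finer than `b` are kept, so that each interval retained has a parent of
  -- scale at least `b`.
  refine ⟨c - 1, ?_⟩
  have h1 : ∑ J ∈ s, T J ≤ ∑' J, {J : DyadicInterval | c - 1 < J.scale}.indicator T J := by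
    refine le_trans (Finset.sum_le_sum fun J hJ => ?_) (ENNReal.sum_le_tsum s)
    have : c ≤ J.scale := hc (by simpa using ⟨J, hJ, rfl⟩)
    rw [Set.indicator_of_mem]
    show c - 1 < J.scale
    omega
  rw [mul_comm, ← ENNReal.div_le_iff_le_mul (by simp) (by simp)]
  exact hs.le.trans h1

end DyadicInterval

/-! ### Haar functions of `μ` and the dyadic Hilbert transform. -/

namespace DyadicHilbert

open DyadicInterval

section Measure

variable {μ : Measure ℝ}

/-- The support lies in `[-2^n, 2^n)` for some `n`, a union of two dyadic intervals and hence of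
finite measure. -/
theorem IsTestFun.memLp (hμ : ∀ I : DyadicInterval, 0 < μ I.toSet ∧ μ I.toSet < ∞) {f : ℝ → ℝ}
    (hf : IsTestFun μ f) (q : ℝ≥0∞) : MemLp f q μ := by
  obtain ⟨M, hM⟩ := hf.bounded
  obtain ⟨R, hR⟩ := hf.hasCompactSupport.isCompact.isBounded.subset_closedBall 0
  obtain ⟨n, hn⟩ := pow_unbounded_of_one_lt R (one_lt_two (α := ℝ))
  set B : Set ℝ := toSet ⟨-n, 0⟩ ∪ toSet ⟨-n, -1⟩ with hB
  have hfB : ∀ x, ‖f x‖ ≤ B.indicator (fun _ => M) x := by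
    intro x
    rw [Real.norm_of_nonneg (hf.nonneg x)]
    by_cases hx : x ∈ B
    · rw [Set.indicator_of_mem hx]
      exact hM x
    · rw [Set.indicator_of_notMem hx]
      refine (image_eq_zero_of_notMem_tsupport fun hxs => hx ?_).le
      have h1 := hR hxs
      rw [mem_closedBall_zero_iff, Real.norm_eq_abs] at h1
      have h2 := abs_le.1 (h1.trans hn.le)
      have h3 := (abs_lt.1 (h1.trans_lt hn)).2
      simp only [hB, toSet, neg_neg, zpow_natCast, Set.mem_union, Set.mem_Ico]
      rcases le_or_gt 0 x with h | h
      · left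
        push_cast
        constructor <;> linarith
      · right
        push_cast
        constructor <;> linarith
  have hBfin : μ B ≠ ∞ := measure_union_ne_top (hμ _).2.ne (hμ _).2.ne
  exact (memLp_indicator_const q ((measurableSet_toSet _).union (measurableSet_toSet _)) M
    (.inr hBfin)).mono' hf.aestronglyMeasurable (.of_forall hfB)

theorem real_pos (hμ : ∀ I : DyadicInterval, 0 < μ I.toSet ∧ μ I.toSet < ∞) (J : DyadicInterval) :
    0 < μ.real J.toSet := ENNReal.toReal_pos (hμ J).1.ne' (hμ J).2.ne

theorem real_add (hμ : ∀ I : DyadicInterval, 0 < μ I.toSet ∧ μ I.toSet < ∞) (J : DyadicInterval) :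
    μ.real J.toSet = μ.real J.left.toSet + μ.real J.right.toSet := by
  rw [toSet_eq_union J, measureReal_union (disjoint_left_right J) (measurableSet_toSet _)
    (hμ _).2.ne (hμ _).2.ne]

theorem avg_mul_real (hμ : ∀ I : DyadicInterval, 0 < μ I.toSet ∧ μ I.toSet < ∞) (f : ℝ → ℝ)
    (J : DyadicInterval) : avg μ f J * μ.real J.toSet = ∫ x in J.toSet, f x ∂μ := by
  rw [avg, setAverage_eq, smul_eq_mul, mul_comm, mul_inv_cancel_left₀ (real_pos hμ J).ne']

theorem isAverage_avg (hμ : ∀ I : DyadicInterval, 0 < μ I.toSet ∧ μ I.toSet < ∞) {f : ℝ → ℝ}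
    (hf : Integrable f μ) (h0 : ∀ x, 0 ≤ f x) :
    IsAverage (fun J => μ.real J.toSet) (avg μ f) where
  nonneg J := by
    rw [avg, setAverage_eq, smul_eq_mul]
    exact mul_nonneg (inv_nonneg.2 measureReal_nonneg) (integral_nonneg h0)
  add J := by
    simp only [avg_mul_real hμ]
    rw [toSet_eq_union J, setIntegral_union (disjoint_left_right J) (measurableSet_toSet _)
      hf.integrableOn hf.integrableOn]

theorem withDensity_toSet (hμ : ∀ I : DyadicInterval, 0 < μ I.toSet ∧ μ I.toSet < ∞) {f : ℝ → ℝ}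
    (hf : Integrable f μ) (h0 : ∀ x, 0 ≤ f x) (J : DyadicInterval) :
    μ.withDensity (fun x => ENNReal.ofReal (f x)) J.toSet =
      ENNReal.ofReal (avg μ f J * μ.real J.toSet) := by
  rw [withDensity_apply _ (measurableSet_toSet J), avg_mul_real hμ,
    ofReal_integral_eq_lintegral_ofReal hf.integrableOn (.of_forall h0)]

theorem avg_eq_of_forall_mem (hμ : ∀ I : DyadicInterval, 0 < μ I.toSet ∧ μ I.toSet < ∞)
    {f : ℝ → ℝ} {J : DyadicInterval} {c : ℝ} (h : ∀ x ∈ J.toSet, f x = c) : avg μ f J = c := by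
  refine mul_right_cancel₀ (real_pos hμ J).ne' ?_
  rw [avg_mul_real hμ, setIntegral_congr_fun (measurableSet_toSet J) h, setIntegral_const,
    smul_eq_mul, mul_comm]

theorem pairing_haar {f : ℝ → ℝ} (hf : Integrable f μ) (J : DyadicInterval) :
    pairing μ f (haar μ J) = √(m μ J) * (avg μ f J.left - avg μ f J.right) := by
  have e : ∀ x, f x * haar μ J x = √(m μ J) *
      ((μ.real J.left.toSet)⁻¹ * J.left.toSet.indicator f x -
      (μ.real J.right.toSet)⁻¹ * J.right.toSet.indicator f x) := by
    intro x
    rw [haar]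
    by_cases h1 : x ∈ J.left.toSet <;> by_cases h2 : x ∈ J.right.toSet <;> simp [h1, h2] <;> ring
  have hi : ∀ K : DyadicInterval,
      Integrable (fun x => (μ.real K.toSet)⁻¹ * K.toSet.indicator f x) μ :=
    fun K => (hf.indicator (measurableSet_toSet K)).const_mul _
  rw [pairing, integral_congr_ae (.of_forall e), integral_const_mul, integral_sub (hi _) (hi _),
    integral_const_mul, integral_const_mul, integral_indicator (measurableSet_toSet _),
    integral_indicator (measurableSet_toSet _), avg, avg, setAverage_eq, setAverage_eq]
  rfl

theorem integrable_haar (hμ : ∀ I : DyadicInterval, 0 < μ I.toSet ∧ μ I.toSet < ∞)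
    (J : DyadicInterval) : Integrable (haar μ J) μ := by
  have h : ∀ K : DyadicInterval,
      Integrable (K.toSet.indicator fun _ => (μ.real K.toSet)⁻¹) μ := fun K =>
    (integrable_indicator_iff (measurableSet_toSet K)).2 (integrableOn_const (hμ K).2.ne)
  exact ((h J.left).sub (h J.right)).const_mul _

theorem haar_of_mem_left {J : DyadicInterval} {x : ℝ} (h : x ∈ J.left.toSet) :
    haar μ J x = √(m μ J) * (μ.real J.left.toSet)⁻¹ := by
  rw [haar, Set.indicator_of_mem h,
    Set.indicator_of_notMem (Set.disjoint_left.1 (disjoint_left_right J) h), sub_zero]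

theorem haar_of_mem_right {J : DyadicInterval} {x : ℝ} (h : x ∈ J.right.toSet) :
    haar μ J x = -(√(m μ J) * (μ.real J.right.toSet)⁻¹) := by
  rw [haar, Set.indicator_of_mem h,
    Set.indicator_of_notMem (Set.disjoint_right.1 (disjoint_left_right J) h), zero_sub, mul_neg]

theorem haar_of_notMem {J : DyadicInterval} {x : ℝ} (h : x ∉ J.toSet) : haar μ J x = 0 := by
  rw [haar, Set.indicator_of_notMem fun h' => h (left_subset J h'),
    Set.indicator_of_notMem fun h' => h (right_subset J h'), sub_zero, mul_zero]

/-- A Haar function is constant on the intervals of finer scale. -/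
theorem haar_eq_of_mem {I J : DyadicInterval} (hs : I.scale < J.scale) {x y : ℝ}
    (hx : x ∈ J.toSet) (hy : y ∈ J.toSet) : haar μ I x = haar μ I y := by
  have h : ∀ K : DyadicInterval, K.scale ≤ J.scale → ∀ c : ℝ,
      K.toSet.indicator (fun _ => c) x = K.toSet.indicator (fun _ => c) y := by
    intro K hK c
    by_cases hxK : x ∈ K.toSet
    · rw [Set.indicator_of_mem hxK, Set.indicator_of_mem (mem_of_scale_le hK hx hy hxK)]
    · rw [Set.indicator_of_notMem hxK,
        Set.indicator_of_notMem fun hyK => hxK (mem_of_scale_le hK hy hx hyK)]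
  rw [haar, haar, h I.left (by rw [left_scale]; omega), h I.right (by rw [right_scale]; omega)]

theorem pairing_haar_self (hμ : ∀ I : DyadicInterval, 0 < μ I.toSet ∧ μ I.toSet < ∞)
    (J : DyadicInterval) : pairing μ (haar μ J) (haar μ J) = 1 := by
  have h1 := real_pos hμ J.left
  have h2 := real_pos hμ J.right
  have h3 := real_add hμ J
  rw [pairing_haar (integrable_haar hμ J), avg_eq_of_forall_mem hμ fun x => haar_of_mem_left,
    avg_eq_of_forall_mem hμ fun x => haar_of_mem_right]
  have e : √(m μ J) * √(m μ J) = m μ J :=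
    Real.mul_self_sqrt (div_nonneg (mul_nonneg h1.le h2.le) measureReal_nonneg)
  calc _ = √(m μ J) * √(m μ J) * ((μ.real J.left.toSet)⁻¹ + (μ.real J.right.toSet)⁻¹) := by ring
    _ = 1 := by
      rw [e, m, h3]
      field_simp
      ring

/-- The Haar function of `I` is constant on `J`, so its averages over the two children of `J`
cancel. -/
theorem pairing_haar_of_scale_le (hμ : ∀ I : DyadicInterval, 0 < μ I.toSet ∧ μ I.toSet < ∞)
    {I J : DyadicInterval} (hs : I.scale ≤ J.scale) (hne : I ≠ J) :
    pairing μ (haar μ I) (haar μ J) = 0 := by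
  rw [pairing_haar (integrable_haar hμ I)]
  obtain ⟨c, hc⟩ : ∃ c, ∀ x ∈ J.toSet, haar μ I x = c := by
    rcases hs.eq_or_lt with hs | hs
    · refine ⟨0, fun x hx => haar_of_notMem fun hxI => hne (eq_of_mem_of_mem hs hxI hx)⟩
    · obtain ⟨y, hy⟩ := nonempty_toSet J
      exact ⟨haar μ I y, fun x hx => haar_eq_of_mem hs hx hy⟩
  rw [avg_eq_of_forall_mem hμ fun x hx => hc x (left_subset J hx),
    avg_eq_of_forall_mem hμ fun x hx => hc x (right_subset J hx), sub_self, mul_zero]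

theorem inner_toLp (F : Lp ℝ 2 μ) {f : ℝ → ℝ} (hf : MemLp f 2 μ) :
    inner ℝ hf.toLp F = pairing μ F f := by
  rw [L2.inner_def, pairing]
  refine integral_congr_ae ?_
  filter_upwards [hf.coeFn_toLp] with x hx
  rw [hx]
  simp

theorem inner_haarLp {f : ℝ → ℝ} (hf : MemLp f 2 μ) (J : DyadicInterval) :
    inner ℝ (haarLp μ J) hf.toLp = pairing μ f (haar μ J) := by
  rw [haarLp, inner_toLp, pairing, pairing]
  refine integral_congr_ae ?_
  filter_upwards [hf.coeFn_toLp] with x hx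
  rw [hx]

theorem orthonormal_haarLp (hμ : ∀ I : DyadicInterval, 0 < μ I.toSet ∧ μ I.toSet < ∞) :
    Orthonormal ℝ (haarLp μ) := by
  classical
  rw [orthonormal_iff_ite]
  intro I J
  split_ifs with h
  · rw [h]
    exact (inner_haarLp (memLp_haar μ J) J).trans (pairing_haar_self hμ J)
  · rcases le_total I.scale J.scale with hs | hs
    · rw [real_inner_comm]
      exact (inner_haarLp (memLp_haar μ I) J).trans (pairing_haar_of_scale_le hμ hs h)
    · exact (inner_haarLp (memLp_haar μ J) I).trans
        (pairing_haar_of_scale_le hμ hs (Ne.symm h))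

theorem summable_sq_pairing_haar (hμ : ∀ I : DyadicInterval, 0 < μ I.toSet ∧ μ I.toSet < ∞)
    {f : ℝ → ℝ} (hf : MemLp f 2 μ) : Summable fun J => pairing μ f (haar μ J) ^ 2 := by
  have h := (orthonormal_haarLp hμ).inner_products_summable hf.toLp
  simpa only [inner_haarLp, Real.norm_eq_abs, sq_abs] using h

theorem summable_smul_haarLp (hμ : ∀ I : DyadicInterval, 0 < μ I.toSet ∧ μ I.toSet < ∞)
    {c : DyadicInterval → ℝ} (hc : Summable fun J => c J ^ 2) :
    Summable fun J => c J • haarLp μ J := by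
  have h := ((orthonormal_haarLp hμ).orthogonalFamily.summable_iff_norm_sq_summable c).2
    (by simpa only [Real.norm_eq_abs, sq_abs] using hc)
  simpa using h

/-- By Bessel, the series `∑ ⟨f, h_{J^s}⟩ h_J` is an orthogonal series with square-summable
coefficients. The Hilbert series is its part over left children minus its part over right children.
-/
theorem summable_hilbertTerm (hμ : ∀ I : DyadicInterval, 0 < μ I.toSet ∧ μ I.toSet < ∞)
    {f : ℝ → ℝ} (hf : MemLp f 2 μ) : Summable (hilbertTerm μ f) := by
  have h := summable_smul_haarLp hμ
    ((summable_sq_pairing_haar hμ hf).comp_injective sibling_injective)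
  have h1 := (h.comp_injective left_injective).sub (h.comp_injective right_injective)
  refine h1.congr fun I => ?_
  simp [hilbertTerm]

/-- Continuity of the inner product allows pairing term by term. The factor 2 comes from extending
the sums over right and over left children each to all intervals. -/
theorem ofReal_abs_pairing_hilbert_le
    (hμ : ∀ I : DyadicInterval, 0 < μ I.toSet ∧ μ I.toSet < ∞) {f₁ f₂ : ℝ → ℝ}
    (hf₁ : MemLp f₁ 2 μ) (hf₂ : MemLp f₂ 2 μ) :
    ENNReal.ofReal |pairing μ (hilbert μ f₁) f₂| ≤
      2 * ∑' J : DyadicInterval, ENNReal.ofReal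
        |pairing μ f₁ (haar μ J) * pairing μ f₂ (haar μ J.sibling)| := by
  set T : DyadicInterval → ℝ≥0∞ := fun J => ENNReal.ofReal
    |pairing μ f₁ (haar μ J) * pairing μ f₂ (haar μ J.sibling)| with hT
  have hs := (summable_hilbertTerm hμ hf₁).hasSum.mapL (innerSL ℝ hf₂.toLp)
  have hterm : ∀ I, innerSL ℝ hf₂.toLp (hilbertTerm μ f₁ I) =
      pairing μ f₁ (haar μ I.right) * pairing μ f₂ (haar μ I.left) -
        pairing μ f₁ (haar μ I.left) * pairing μ f₂ (haar μ I.right) := by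
    intro I
    rw [innerSL_apply_apply, hilbertTerm, inner_sub_right, inner_smul_right, inner_smul_right,
      real_inner_comm, inner_haarLp, real_inner_comm, inner_haarLp]
  have hval : innerSL ℝ hf₂.toLp (∑' I, hilbertTerm μ f₁ I) = pairing μ (hilbert μ f₁) f₂ :=
    inner_toLp _ hf₂
  rw [hval] at hs
  rw [← hs.tsum_eq, ← Real.enorm_eq_ofReal_abs]
  refine (enorm_tsum_le_tsum_enorm).trans ?_
  have hle : ∀ I, ‖innerSL ℝ hf₂.toLp (hilbertTerm μ f₁ I)‖ₑ ≤ T I.right + T I.left := by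
    intro I
    rw [hterm, Real.enorm_eq_ofReal_abs]
    refine (ENNReal.ofReal_le_ofReal (abs_sub _ _)).trans ?_
    refine ENNReal.ofReal_add_le.trans (le_of_eq ?_)
    simp only [hT, right_sibling, left_sibling]
  refine (ENNReal.tsum_le_tsum hle).trans ?_
  rw [ENNReal.tsum_add, two_mul]
  exact add_le_add (ENNReal.tsum_comp_le_tsum_of_injective right_injective T)
    (ENNReal.tsum_comp_le_tsum_of_injective left_injective T)

/-- Finiteness is what permits the truncation in `exists_tsum_le_two_mul`. -/
theorem tsum_pairing_haar_ne_top (hμ : ∀ I : DyadicInterval, 0 < μ I.toSet ∧ μ I.toSet < ∞)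
    {f₁ f₂ : ℝ → ℝ} (hf₁ : MemLp f₁ 2 μ) (hf₂ : MemLp f₂ 2 μ) :
    ∑' J : DyadicInterval, ENNReal.ofReal
      |pairing μ f₁ (haar μ J) * pairing μ f₂ (haar μ J.sibling)| ≠ ∞ := by
  have h1 := summable_sq_pairing_haar hμ hf₁
  have h2 := (summable_sq_pairing_haar hμ hf₂).comp_injective sibling_injective
  refine Summable.tsum_ofReal_ne_top
    (Summable.of_nonneg_of_le (fun _ => abs_nonneg _) (fun J => ?_) (h1.add h2))
  rw [abs_mul]
  simp only [Function.comp]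
  rw [← sq_abs (pairing μ f₁ _), ← sq_abs (pairing μ f₂ _)]
  nlinarith [two_mul_le_add_sq |pairing μ f₁ (haar μ J)| |pairing μ f₂ (haar μ J.sibling)|,
    mul_nonneg (abs_nonneg (pairing μ f₁ (haar μ J)))
      (abs_nonneg (pairing μ f₂ (haar μ J.sibling)))]

theorem m_pos (hμ : ∀ I : DyadicInterval, 0 < μ I.toSet ∧ μ I.toSet < ∞) (J : DyadicInterval) :
    0 < m μ J :=
  branch_pos (p := fun J => μ.real J.toSet) (real_pos hμ) J

theorem m_div_le_sibConst (hsib : SiblingBalanced μ) (J : DyadicInterval) :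
    m μ J / m μ J.sibling ≤ (sibConst μ).toReal := by
  rw [← ENNReal.ofReal_le_iff_le_toReal (ne_of_lt hsib)]
  exact le_iSup (fun I : DyadicInterval => ENNReal.ofReal (m μ I / m μ I.sibling)) J

/-- The ratios at an interval and at its sibling are reciprocal, so one of them is at least 1. -/
theorem one_le_sibConst (hμ : ∀ I : DyadicInterval, 0 < μ I.toSet ∧ μ I.toSet < ∞)
    (hsib : SiblingBalanced μ) : 1 ≤ (sibConst μ).toReal := by
  have h1 := m_div_le_sibConst hsib ⟨0, 0⟩
  have h2 := m_div_le_sibConst hsib (sibling ⟨0, 0⟩)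
  rw [sibling_sibling] at h2
  have p1 := m_pos hμ ⟨0, 0⟩
  have p2 := m_pos hμ (sibling ⟨0, 0⟩)
  rcases le_total (m μ ⟨0, 0⟩) (m μ (sibling ⟨0, 0⟩)) with h | h
  · exact ((one_le_div p1).2 h).trans h2
  · exact ((one_le_div p2).2 h).trans h1

theorem sqrt_m_le (hμ : ∀ I : DyadicInterval, 0 < μ I.toSet ∧ μ I.toSet < ∞)
    (hsib : SiblingBalanced μ) (J : DyadicInterval) :
    √(m μ J) ≤ √(sibConst μ).toReal * √(m μ J.sibling) := by
  rw [← Real.sqrt_mul ENNReal.toReal_nonneg]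
  exact Real.sqrt_le_sqrt ((div_le_iff₀ (m_pos hμ _)).1 (m_div_le_sibConst hsib J))

theorem sibForm₃_eq (S : Set DyadicInterval) (f₁ f₂ : ℝ → ℝ) :
    sibForm₃ μ S f₁ f₂ = uncleForm S (fun J => μ.real J.toSet) (avg μ f₂) (avg μ f₁) := by
  let e : {q : DyadicInterval × DyadicInterval // q.1 ∈ S ∧ q.2 ∈ S ∧ q.2 = q.1.parent.sibling} ≃
      {q : DyadicInterval × DyadicInterval | q.1 ∈ S ∧ q.2 ∈ S ∧ q.1 = q.2.parent.sibling} :=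
    (Equiv.prodComm _ _).subtypeEquiv fun q => by
      simp only [Equiv.prodComm_apply, Set.mem_ofPred_eq, Prod.fst_swap, Prod.snd_swap]
      tauto
  rw [sibForm₃, uncleForm, ← e.tsum_eq]
  refine tsum_congr fun q => congrArg ENNReal.ofReal ?_
  change avg μ f₁ q.1.1 * avg μ f₂ q.1.2 * √(m μ q.1.1.parent) * √(m μ q.1.2) =
    avg μ f₂ q.1.2 * avg μ f₁ q.1.1 * √(m μ q.1.2) * √(m μ q.1.1.parent)
  ring

end Measure

end DyadicHilbert

/-! ### The sparse domination theorem. -/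

theorem mainTheorem6 :
    ∃ C : ℝ, 0 < C ∧ ∃ η : ℝ, 0 < η ∧ η < 1 ∧
      ∀ μ : Measure ℝ,
        (∀ I : DyadicInterval, 0 < μ I.toSet ∧ μ I.toSet < ∞) →
        μ (Set.Ici 0) = ∞ → μ (Set.Iio 0) = ∞ →
        DyadicHilbert.SiblingBalanced μ →
        (∀ x : ℝ, μ {x} = 0) →
        ∀ f₁ f₂ : ℝ → ℝ, DyadicHilbert.IsTestFun μ f₁ → DyadicHilbert.IsTestFun μ f₂ →
          Summable (DyadicHilbert.hilbertTerm μ f₁) ∧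
          Integrable (fun x => DyadicHilbert.hilbert μ f₁ x * f₂ x) μ ∧
          ∃ S : Set DyadicInterval, DyadicHilbert.IsSparse μ η S ∧
            ENNReal.ofReal |DyadicHilbert.pairing μ (DyadicHilbert.hilbert μ f₁) f₂| ≤
              ENNReal.ofReal C *
                (DyadicHilbert.sibConst μ ^ (1 / 2 : ℝ) * DyadicHilbert.sparseForm μ S f₁ f₂ +
                  (DyadicHilbert.sibForm₁ μ S f₁ f₂ + DyadicHilbert.sibForm₂ μ S f₁ f₂ +
                    DyadicHilbert.sibForm₃ μ S f₁ f₂)) := by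
  open DyadicHilbert DyadicInterval in
  -- `9568 = 2 · 2 · 2392`: the two halves of the Hilbert series, the truncation in scale, and the
  -- constant of `tsum_coef_mul_coef_le`.
  refine ⟨9568, by norm_num, 1 / 2, by norm_num, by norm_num, ?_⟩
  intro μ hμ _ _ hsib _ f₁ f₂ hf₁ hf₂
  have hL₁ := hf₁.memLp hμ 2
  have hL₂ := hf₂.memLp hμ 2
  have hI₁ := memLp_one_iff_integrable.1 (hf₁.memLp hμ 1)
  have hI₂ := memLp_one_iff_integrable.1 (hf₂.memLp hμ 1)
  refine ⟨summable_hilbertTerm hμ hL₁, (Lp.memLp _).integrable_mul hL₂, ?_⟩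
  obtain ⟨b, hb⟩ := exists_tsum_le_two_mul _ (tsum_pairing_haar_ne_top hμ hL₁ hL₂)
  have h₁ := isAverage_avg hμ hI₁ hf₁.nonneg
  have h₂ := isAverage_avg hμ hI₂ hf₂.nonneg
  have hν₁ := withDensity_toSet hμ hI₁ hf₁.nonneg
  have hν₂ := withDensity_toSet hμ hI₂ hf₂.nonneg
  have hp := real_pos hμ
  have hadd := real_add hμ
  have hμp : ∀ J : DyadicInterval, μ J.toSet = ENNReal.ofReal (μ.real J.toSet) := fun J =>
    (ofReal_measureReal (hμ J).2.ne).symm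
  have hβ : 1 ≤ √(sibConst μ).toReal := Real.one_le_sqrt.2 (one_le_sibConst hμ hsib)
  have hβ' : ENNReal.ofReal √(sibConst μ).toReal = sibConst μ ^ (1 / 2 : ℝ) := by
    rw [Real.sqrt_eq_rpow, ← ENNReal.ofReal_rpow_of_nonneg ENNReal.toReal_nonneg (by norm_num),
      ENNReal.ofReal_toReal (ne_of_lt hsib)]
  refine ⟨stopping (jump (avg μ f₁) (avg μ f₂)) b, ?_, ?_⟩
  · exact isSparse_stopping μ (fun I => (hμ I).2.ne) fun Q _ =>
      tsum_stoppingChildren_jump_le hp h₁.nonneg h₂.nonneg hμp hν₁ hν₂ Q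
  have core := tsum_coef_mul_coef_le (halt := jump (avg μ f₁) (avg μ f₂)) (b := b)
    (p := fun J => μ.real J.toSet) hp hadd h₁ h₂ hμp hν₁ hν₂
    (le_four_mul_own h₁.nonneg fun Q K h => not_lt.1 fun h' => h (.inl h'))
    (le_four_mul_own h₂.nonneg fun Q K h => not_lt.1 fun h' => h (.inr h'))
    hβ (sqrt_m_le hμ hsib)
  have hcoef : (fun J : DyadicInterval => ENNReal.ofReal
      |pairing μ f₁ (haar μ J) * pairing μ f₂ (haar μ J.sibling)|) =
      fun J : DyadicInterval => ENNReal.ofReal |coef (fun J => μ.real J.toSet) (avg μ f₁) J *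
        coef (fun J => μ.real J.toSet) (avg μ f₂) J.sibling| := by
    funext J
    rw [pairing_haar hI₁, pairing_haar hI₂]
    rfl
  rw [← hcoef, hβ', ← sibForm₃_eq _ f₁ f₂] at core
  refine (ofReal_abs_pairing_hilbert_le hμ hL₁ hL₂).trans
    ((mul_le_mul_right (hb.trans (mul_le_mul_right core _)) _).trans_eq ?_)
  rw [← mul_assoc, ← mul_assoc, ENNReal.ofReal_ofNat,
    show (2 * 2 * 2392 : ℝ≥0∞) = 9568 by norm_num]
  rfl
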